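/- **Setting.** Let $\mathcal X,\mathcal Y,\mathcal Z$ be finite sets, $p_{XY}$ a probability distribution on $\mathcal X\times\mathcal Y$, and $p_{Z|XY}$ a randomized function (a probability distribution on $\mathcal Z$ for each $(x,y)\in\mathcal X\times\mathcal Y$). All logarithms are to base 2. For random variables on a finite probability space, $RI(U;V)=I(U;V)-H(U\sqcap V)$ is the residual information, where $H(U\sqcap V)$ is the largest entropy of a random variable $Q$ with $Q=f(U)=g(V)$ almost surely for some functions $f,g$. *Protocols.* Alice (party 1) has input $X$, Bob (party 2) has input $Y$, Charlie (party 3) has no input and produces an output. The parties communicate in rounds over three private pairwise links. In each round each party draws its two outgoing messages (possibly empty bit strings) from a distribution that depends on its own input and on the messages exchanged so far on its own two links; given these, the parties draw independently. The protocol is well-formed if (i) every message sent by a party to another in a round is a codeword of a prefix-free code determined by the messages exchanged between these two parties in the previous rounds, and (ii) with probability 1 the protocol terminates, i.e. it reaches a state from which on all parties send only empty strings. The transcript $M_{ij}$ of the link $ij\in\{12,23,31\}$ is the pair of strings obtained by concatenating all bits sent in each of the two directions. Charlie's output $Z$ is drawn from a distribution depending on $(M_{23},M_{31})$. The protocol may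 depend on $p_{XY}$. It is a secure protocol $\Pi(p_{XY},p_{Z|XY})$ if it is well-formed and, when $(X,Y)\sim p_{XY}$, the triple $(X,Y,Z)$ has distribution $p_{XY}(x,y)\,p_{Z|XY}(z|x,y)$ (correctness) and the Markov chains $(M_{12},M_{31})-X-(Y,Z)$, $(M_{12},M_{23})-Y-(X,Z)$ and $(M_{23},M_{31})-Z-(X,Y)$ hold (privacy against each single party). *Normal form.* $p_{Z|XY}$ is in normal form if: $x=x'$ whenever $p(z|x,y)=p(z|x',y)$ for all $y,z$; $y=y'$ whenever $p(z|x,y)=p(z|x,y')$ for all $x,z$; and $z=z'$ whenever there is a constant $c\ge 0$ with $p(z|x,y)=c\,p(z'|x,y)$ for all $x,y$. *Condition 1.* There is no partition $\mathcal X=\mathcal X_1\cup\mathcal X_2$ into two disjoint non-empty sets such that the sets $\mathcal Z_k=\{z: p(z|x,y)>0\text{ for some }x\in\mathcal X_k,\,y\in\mathcal Y\}$, $k=1,2$, are disjoint. *Condition 2.* There is no partition $\mathcal Y=\mathcal Y_1\cup\mathcal Y_2$ into two disjoint non-empty sets such that the sets $\mathcal Z_k=\{z: p(z|x,y)>0\text{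 for some }x\in\mathcal X,\,y\in\mathcal Y_k\}$, $k=1,2$, are disjoint. **Theorem.** Let $p_{XY}$ have full support ($p_{XY}(x,y)>0$ for all $x,y$), let $p_{Z|XY}$ be in normal form, and let $\Pi(p_{XY},p_{Z|XY})$ be any secure protocol, with transcripts $M_{12},M_{23},M_{31}$ (whose entropies may be infinite). Below, the suprema are over all distributions $p_{X'Y'}$ on $\mathcal X\times\mathcal Y$ with full support, and the expressions are evaluated for $p_{X'Y'Z'}(x,y,z)=p_{X'Y'}(x,y)\,p_{Z|XY}(z|x,y)$. 1. $$H(M_{12})\ \ge\ \max\Big\{\sup_{p_{X'Y'}}\big(RI(X';Z')+H(X',Y'|Z')\big),\ \sup_{p_{X'Y'}}\big(RI(Y';Z')+H(X',Y'|Z')\big)\Big\}.$$ 2. If $p_{Z|XY}$ satisfies Condition 1, then $$H(M_{31})\ \ge\ \max\Big\{\sup_{p_{X'Y'}}\big(RI(Y';Z')+H(X',Z'|Y')\big),\ \sup_{p_{X'Y'}}\big(RI(X';Y')+H(X',Z'|Y')\big)\Big\}.$$ 3. If $p_{Z|XY}$ satisfies Condition 2, then $$H(M_{23})\ \ge\ \max\Big\{\sup_{p_{X'Y'}}\big(RI(X';Z')+H(Y',Z'|X')\big),\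 \sup_{p_{X'Y'}}\big(RI(X';Y')+H(Y',Z'|X')\big)\Big\}.$$ -/

import Mathlib

open scoped ENNReal NNReal

noncomputable section

namespace SecureThree

universe u v w

/-! ### Information measures (all logarithms are to base 2) -/

/-- Shannon entropy, in bits, of a discrete distribution.  It may be infinite when the
alphabet is infinite. -/
def entropy {α : Type*} (p : PMF α) : ℝ≥0∞ :=
  ∑' a, ENNReal.ofReal (Real.negMulLog (p a).toReal / Real.log 2)

/-- The entropy `H(U)` of a random variable `U` on a *finite* probability space `(Ω, p)`, where
it is a real number. -/
def rvEntropy {Ω : Type*} [Finite Ω] {α : Type*} (p : PMF Ω) (U : Ω → α) : ℝ :=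
  (entropy (p.map U)).toReal

/-- Conditional entropy `H(U | V) = H(U, V) - H(V)`. -/
def condEntropy {Ω : Type*} [Finite Ω] {α β : Type*} (p : PMF Ω) (U : Ω → α) (V : Ω → β) : ℝ :=
  rvEntropy p (fun ω => (U ω, V ω)) - rvEntropy p V

/-- Mutual information `I(U; V) = H(U) + H(V) - H(U, V)`. -/
def mutualInfo {Ω : Type*} [Finite Ω] {α β : Type*} (p : PMF Ω) (U : Ω → α) (V : Ω → β) : ℝ :=
  rvEntropy p U + rvEntropy p V - rvEntropy p (fun ω => (U ω, V ω))

/-- Gács–Körner common information: the largest entropy of a random variable `Q` that is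
determined both by `U` and by `V`, i.e. `Q = f(U) = g(V)` almost surely.  The space is
finite, so labelling the values of `Q` by natural numbers is no restriction. -/
def commonInfo {Ω : Type*} [Finite Ω] {α β : Type*} (p : PMF Ω) (U : Ω → α) (V : Ω → β) : ℝ :=
  sSup {h : ℝ | ∃ (f : α → ℕ) (g : β → ℕ),
    (∀ ω ∈ p.support, f (U ω) = g (V ω)) ∧ h = rvEntropy p (fun ω => f (U ω))}

/-- Residual information `RI(U; V)`. -/
def residualInfo {Ω : Type*} [Finite Ω] {α β : Type*} (p : PMF Ω) (U : Ω → α) (V : Ω → β) : ℝ :=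
  mutualInfo p U V - commonInfo p U V

/-- The Markov chain `T - U - V`: `T` and `V` are conditionally independent given `U`. -/
def IsMarkovChain {Ω α β γ : Type*} (p : PMF Ω) (T : Ω → α) (U : Ω → β) (V : Ω → γ) : Prop :=
  ∀ a b c, p.map (fun ω => (T ω, U ω, V ω)) (a, b, c) * p.map U b =
    p.map (fun ω => (T ω, U ω)) (a, b) * p.map (fun ω => (U ω, V ω)) (b, c)

/-! ### Three-party protocols -/

/-- The messages exchanged so far on a link, one entry for each round, in chronological order.
On the link `ij` (one of `12`, `23`, `31`) an entry is the pair (message from `i` to `j`,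
message from `j` to `i`) of bit strings.  Sending nothing is sending the empty string. -/
abbrev LinkHistory : Type := List (List Bool × List Bool)

/-- The transcript on a link: for each of the two directions, the concatenation of all the
bits sent. -/
abbrev LinkTranscript : Type := List Bool × List Bool

/-- Concatenation of the messages on a link, in each direction. -/
def LinkHistory.transcript (l : LinkHistory) : LinkTranscript :=
  ((l.map Prod.fst).flatten, (l.map Prod.snd).flatten)

/-- The messages exchanged so far on all three links. -/
structure History where
  l12 : LinkHistory
  l23 : LinkHistory
  l31 : LinkHistory

/-- The history `h` followed by `k` rounds in which nobody sends anything. -/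
def History.silence (h : History) (k : ℕ) : History where
  l12 := h.l12 ++ List.replicate k ([], [])
  l23 := h.l23 ++ List.replicate k ([], [])
  l31 := h.l31 ++ List.replicate k ([], [])

/-- The transcripts on the three links. -/
structure Transcripts where
  m12 : LinkTranscript
  m23 : LinkTranscript
  m31 : LinkTranscript

/-- The transcripts obtained from a history. -/
def History.transcripts (h : History) : Transcripts where
  m12 := h.l12.transcript
  m23 := h.l23.transcript
  m31 := h.l31.transcript

/-- A three-party protocol in which party 1 (Alice) has an input in `X`, party 2 (Bob) has an
input in `Y`, and party 3 (Charlie) produces an output in `Z`.  In every round each party draws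
its two outgoing messages from a distribution that depends on its own input (if any) and the
messages so far on its own two links. -/
structure Protocol (X : Type u) (Y : Type v) (Z : Type w) where
  /-- Alice: input, history of link 12, history of link 31 ↦ (message to Bob, to Charlie). -/
  next1 : X → LinkHistory → LinkHistory → PMF (List Bool × List Bool)
  /-- Bob: input, history of link 12, history of link 23 ↦ (message to Alice, to Charlie). -/
  next2 : Y → LinkHistory → LinkHistory → PMF (List Bool × List Bool)
  /-- Charlie: history of link 23, history of link 31 ↦ (message to Alice, to Bob). -/
  next3 : LinkHistory → LinkHistory → PMF (List Bool × List Bool)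
  /-- Charlie's output, given the final transcripts on the links 23 and 31. -/
  out3 : LinkTranscript → LinkTranscript → PMF Z

/-- Everything that is determined by an execution: inputs, output, final transcripts. -/
structure Outcome (X : Type u) (Y : Type v) (Z : Type w) where
  x : X
  y : Y
  z : Z
  m12 : LinkTranscript
  m23 : LinkTranscript
  m31 : LinkTranscript

/-- No codeword is a proper prefix of another one. -/
def PrefixFree (C : Set (List Bool)) : Prop :=
  ∀ a ∈ C, ∀ b ∈ C, a <+: b → a = b

namespace Protocol

variable {X : Type u} {Y : Type v} {Z : Type w}

/-- One round of the protocol on inputs `x`, `y`: the parties draw their messages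
independently, given their views, and the messages are appended to the histories. -/
def step (P : Protocol X Y Z) (x : X) (y : Y) (h : History) : PMF History :=
  (P.next1 x h.l12 h.l31).bind fun a =>
  (P.next2 y h.l12 h.l23).bind fun b =>
  (P.next3 h.l23 h.l31).bind fun c =>
  PMF.pure
    { l12 := h.l12 ++ [(a.1, b.1)]
      l23 := h.l23 ++ [(b.2, c.2)]
      l31 := h.l31 ++ [(c.1, a.2)] }

/-- The distribution of the history after `t` rounds on inputs `x`, `y`. -/
def run (P : Protocol X Y Z) (x : X) (y : Y) : ℕ → PMF History
  | 0 => PMF.pure ⟨[], [], []⟩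
  | t + 1 => (P.run x y t).bind (P.step x y)

/-- The protocol has terminated at the history `h`: from `h` on, all three parties output
empty strings. -/
def Terminated (P : Protocol X Y Z) (x : X) (y : Y) (h : History) : Prop :=
  ∀ k : ℕ,
    P.next1 x (h.silence k).l12 (h.silence k).l31 = PMF.pure ([], []) ∧
    P.next2 y (h.silence k).l12 (h.silence k).l23 = PMF.pure ([], []) ∧
    P.next3 (h.silence k).l23 (h.silence k).l31 = PMF.pure ([], [])

/-- The probability that, on inputs `x`, `y`, the protocol terminates with final transcripts
`m`: the supremum (an increasing limit) over `t` of the probability that it has done so after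
`t` rounds. -/
def finalMass (P : Protocol X Y Z) (x : X) (y : Y) (m : Transcripts) : ℝ≥0∞ :=
  ⨆ t : ℕ, (P.run x y t).toOuterMeasure {h | P.Terminated x y h ∧ h.transcripts = m}

/-- On every pair of inputs that occurs, the protocol terminates with probability 1. -/
def Terminates (P : Protocol X Y Z) (pXY : PMF (X × Y)) : Prop :=
  ∀ s ∈ pXY.support, ∑' m, P.finalMass s.1 s.2 m = 1

/-- In every round and in each direction of each link, the message sent is a codeword of a
prefix-free code that is determined by the messages exchanged on that link in the previous
rounds; `cij` is the code for messages from party `i` to party `j`. -/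
def UsesPrefixFreeCodes (P : Protocol X Y Z) (pXY : PMF (X × Y)) : Prop :=
  ∃ c12 c21 c23 c32 c31 c13 : LinkHistory → Set (List Bool),
    (∀ l, PrefixFree (c12 l) ∧ PrefixFree (c21 l) ∧ PrefixFree (c23 l) ∧
      PrefixFree (c32 l) ∧ PrefixFree (c31 l) ∧ PrefixFree (c13 l)) ∧
    ∀ s ∈ pXY.support, ∀ t : ℕ, ∀ h ∈ (P.run s.1 s.2 t).support,
      (∀ a ∈ (P.next1 s.1 h.l12 h.l31).support, a.1 ∈ c12 h.l12 ∧ a.2 ∈ c13 h.l31) ∧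
      (∀ b ∈ (P.next2 s.2 h.l12 h.l23).support, b.1 ∈ c21 h.l12 ∧ b.2 ∈ c23 h.l23) ∧
      (∀ c ∈ (P.next3 h.l23 h.l31).support, c.1 ∈ c31 h.l31 ∧ c.2 ∈ c32 h.l23)

/-- Well-formed protocols, for the input distribution `pXY`. -/
structure IsWellFormed (P : Protocol X Y Z) (pXY : PMF (X × Y)) : Prop where
  prefixFree : P.UsesPrefixFreeCodes pXY
  terminates : P.Terminates pXY

/-- The distribution of the final transcripts on inputs `s` that occur. -/
def finalLaw (P : Protocol X Y Z) (pXY : PMF (X × Y)) (hP : P.IsWellFormed pXY) (s : X × Y)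
    (hs : s ∈ pXY.support) : PMF Transcripts :=
  ⟨P.finalMass s.1 s.2, hP.terminates s hs ▸ ENNReal.summable.hasSum⟩

/-- The joint distribution of inputs, output and final transcripts defined by a well-formed
protocol and an input distribution. -/
def law (P : Protocol X Y Z) (pXY : PMF (X × Y)) (hP : P.IsWellFormed pXY) :
    PMF (Outcome X Y Z) :=
  pXY.bindOnSupport fun s hs =>
    (P.finalLaw pXY hP s hs).bind fun m =>
    (P.out3 m.m23 m.m31).map fun z => ⟨s.1, s.2, z, m.m12, m.m23, m.m31⟩

end Protocol

/-! ### Secure computation -/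

/-- The joint distribution `p(x, y, z) = p(x, y) p(z | x, y)`. -/
def jointXYZ {X : Type u} {Y : Type v} {Z : Type w} (pXY : PMF (X × Y))
    (pZ : X → Y → PMF Z) : PMF (X × Y × Z) :=
  pXY.bind fun s => (pZ s.1 s.2).map fun z => (s.1, s.2, z)

/-- A well-formed protocol is a (perfectly) secure computation protocol for the input
distribution `pXY` and the randomized function `pZ`. -/
structure Protocol.IsSecure {X : Type u} {Y : Type v} {Z : Type w} (P : Protocol X Y Z)
    (pXY : PMF (X × Y)) (pZ : X → Y → PMF Z) (hP : P.IsWellFormed pXY) : Prop where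
  /-- Charlie's output is distributed according to `pZ x y` on inputs `x`, `y`. -/
  correct : (P.law pXY hP).map (fun o => (o.x, o.y, o.z)) = jointXYZ pXY pZ
  /-- Privacy against Alice: `M₁ - X - (Y, Z)`. -/
  private1 : IsMarkovChain (P.law pXY hP) (fun o => (o.m12, o.m31)) (fun o => o.x)
    (fun o => (o.y, o.z))
  /-- Privacy against Bob: `M₂ - Y - (X, Z)`. -/
  private2 : IsMarkovChain (P.law pXY hP) (fun o => (o.m12, o.m23)) (fun o => o.y)
    (fun o => (o.x, o.z))
  /-- Privacy against Charlie: `M₃ - Z - (X, Y)`. -/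
  private3 : IsMarkovChain (P.law pXY hP) (fun o => (o.m23, o.m31)) (fun o => o.z)
    (fun o => (o.x, o.y))

/-- `pXY` gives positive probability to every pair. -/
def FullSupport {X : Type u} {Y : Type v} (pXY : PMF (X × Y)) : Prop :=
  ∀ x y, pXY (x, y) ≠ 0

/-- The randomized function `pZ` is in normal form: it has no two equivalent elements in
the alphabet of either input or of the output. -/
structure NormalForm {X : Type u} {Y : Type v} {Z : Type w} (pZ : X → Y → PMF Z) : Prop where
  left : ∀ x x', (∀ y z, pZ x y z = pZ x' y z) → x = x'
  right : ∀ y y', (∀ x z, pZ x y z = pZ x y' z) → y = y'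
  output : ∀ z z', (∃ c : ℝ≥0, ∀ x y, pZ x y z = c * pZ x y z') → z = z'

/-- Condition 1: no non-trivial partition of `X` into two parts whose sets of possible
outputs are disjoint. -/
def Condition1 {X : Type u} {Y : Type v} {Z : Type w} (pZ : X → Y → PMF Z) : Prop :=
  ¬ ∃ A B : Set X, A ∪ B = Set.univ ∧ A ∩ B = ∅ ∧ A.Nonempty ∧ B.Nonempty ∧
    {z | ∃ x ∈ A, ∃ y, 0 < pZ x y z} ∩ {z | ∃ x ∈ B, ∃ y, 0 < pZ x y z} = ∅

/-- Condition 2: no non-trivial partition of `Y` into two parts whose sets of possible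
outputs are disjoint. -/
def Condition2 {X : Type u} {Y : Type v} {Z : Type w} (pZ : X → Y → PMF Z) : Prop :=
  ¬ ∃ A B : Set Y, A ∪ B = Set.univ ∧ A ∩ B = ∅ ∧ A.Nonempty ∧ B.Nonempty ∧
    {z | ∃ x, ∃ y ∈ A, 0 < pZ x y z} ∩ {z | ∃ x, ∃ y ∈ B, 0 < pZ x y z} = ∅

/-- The coordinates of `(x, y, z)` as random variables. -/
def rvX {X : Type u} {Y : Type v} {Z : Type w} (s : X × Y × Z) : X := s.1

/-- See `rvX`. -/
def rvY {X : Type u} {Y : Type v} {Z : Type w} (s : X × Y × Z) : Y := s.2.1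

/-- See `rvX`. -/
def rvZ {X : Type u} {Y : Type v} {Z : Type w} (s : X × Y × Z) : Z := s.2.2

/-- The supremum, over all distributions `q` on `X × Y` with full support, of the value of `F` at
the joint distribution `q(x, y) p(z | x, y)`. -/
def supFullSupport {X : Type u} {Y : Type v} {Z : Type w} (pZ : X → Y → PMF Z)
    (F : PMF (X × Y × Z) → ℝ) : EReal :=
  ⨆ q : {q : PMF (X × Y) // FullSupport q}, ((F (jointXYZ q.1 pZ) : ℝ) : EReal)

end SecureThree

end

namespace SecureThree

open Finset

/-! ### Entropy of discrete variables and a Gibbs inequality. -/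

section Information

variable {Ω α β γ δ ε : Type*}

/-! Each of the six bounds is one inequality about three discrete variables `A`, `B`, `C` (the link
transcripts, `A` on the link to be bounded) and a finite variable S determined by U, V, W. Here V
belongs to the party that is not on link `A`, W to the party on links `A` and `B`, U to the party on
links `A` and `C`. Three facts are needed: privacy gives the Markov chains (B,C) - V - S and (A,B) -
W - S; the view (A,B) determines W and (A,C) determines U; and the law of `A` stays the same when
the input distribution is replaced by an arbitrary q.

The information-theoretic core is `residualInfo_add_condEntropy_le_entropy`. The conditional law of
`B` given S is a function of V and also of W, so the label Q of that law is a common variable of V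
and W, and H(Q) is at most the common information. With w(s) = P(Q) P(V,W) / (P(W) P(S)) evaluated
at s, E[log w(S)] = H(W) + H(S) - H(Q) - H(V,W), which is at least the desired lower bound. By Gibbs
(`sum_log_le_entropy`) this is at most H(A) once E[ρ(A) w(S)] ≤ 1, where ρ is the law of `A`;
determinacy of W and U gives that estimate.

That views determine inputs rests on a cut-and-paste property. The probability of a history is a
product of one factor per party (`exists_run_eq_mul`), so inputs of a party can be exchanged between
two executions in which its view is the same. Prefix-freeness carries this from histories to
transcripts. If x and x' were compatible with the same view of Alice, exchange and privacy would
give p(z|x,y) = p(z|x',y) for all y, z, and normal form forces x = x'; Bob is symmetric. For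
Charlie, the output kernel makes two compatible outputs proportional.

Finally, the conditional law of `M₁₂` depends only on x and only on y, hence on neither. For `M₃₁`
it is a function of x and a function of z, and Condition 1 is the connectedness that makes it
constant; Condition 2 does the same for `M₂₃`. -/

theorem map_apply_eq_tsum_of_fiber {ι : Type*} (p : PMF Ω) (f : Ω → α) (b : α) (e : ι → Ω)
    (he : Function.Injective e) (hf : ∀ ω, f ω = b ↔ ω ∈ Set.range e) :
    p.map f b = ∑' i, p (e i) := by
  classical
  rw [PMF.map_apply]
  have : ∀ ω, (if b = f ω then p ω else 0) = (Set.range e).indicator p ω := by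
    intro ω
    by_cases h : ω ∈ Set.range e
    · rw [Set.indicator_of_mem h, if_pos ((hf ω).2 h).symm]
    · rw [Set.indicator_of_notMem h, if_neg (fun h' => h ((hf ω).1 h'.symm))]
  rw [tsum_congr (fun ω => this ω), ← _root_.tsum_subtype, tsum_range (fun ω => p ω) he]

theorem map_apply_le_map_comp (p : PMF Ω) (f : Ω → α) (g : α → β) (a : α) :
    p.map f a ≤ p.map (g ∘ f) (g a) := by
  classical
  rw [PMF.map_apply, PMF.map_apply]
  refine ENNReal.tsum_le_tsum fun ω => ?_
  by_cases h : a = f ω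
  · simp [h]
  · simp [h]

theorem apply_le_map_apply (p : PMF Ω) (f : Ω → α) (ω : Ω) : p ω ≤ p.map f (f ω) := by
  simpa [PMF.map_id] using map_apply_le_map_comp p id f ω

theorem map_apply_fintype [Fintype Ω] [DecidableEq α] (p : PMF Ω) (f : Ω → α) (b : α) :
    p.map f b = ∑ ω with f ω = b, p ω := by
  rw [PMF.map_apply, tsum_fintype, sum_filter]
  refine sum_congr rfl fun ω _ => ?_
  by_cases h : f ω = b
  · simp [h]
  · rw [if_neg h, if_neg (fun h' => h h'.symm)]

/-- The entropy of a random variable on a finite space as an expectation. -/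
theorem rvEntropy_eq_sum [Fintype Ω] (p : PMF Ω) (U : Ω → α) :
    rvEntropy p U =
      ∑ ω, (p ω).toReal * (-Real.log (p.map U (U ω)).toReal / Real.log 2) := by
  classical
  have hzero : ∀ a, a ∉ univ.image U → p.map U a = 0 := by
    intro a ha
    rw [map_apply_fintype]
    refine sum_eq_zero fun ω hω => absurd (mem_image.2 ⟨ω, mem_univ _, (mem_filter.1 hω).2⟩) ha
  have hnn : ∀ a, 0 ≤ Real.negMulLog (p.map U a).toReal / Real.log 2 := fun a =>
    div_nonneg (Real.negMulLog_nonneg ENNReal.toReal_nonneg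
      (ENNReal.toReal_mono ENNReal.one_ne_top ((p.map U).coe_le_one a)))
      (Real.log_nonneg (by norm_num))
  have h1 : entropy (p.map U) =
      ∑ a ∈ univ.image U, ENNReal.ofReal (Real.negMulLog (p.map U a).toReal / Real.log 2) := by
    rw [entropy, tsum_eq_sum]
    intro a ha
    simp [hzero a ha]
  rw [rvEntropy, h1, ENNReal.toReal_sum (fun a _ => ENNReal.ofReal_ne_top)]
  rw [← sum_fiberwise_of_maps_to (g := U) (t := univ.image U)
    (fun ω _ => mem_image_of_mem U (mem_univ ω))]
  refine sum_congr rfl fun a _ => ?_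
  rw [ENNReal.toReal_ofReal (hnn a)]
  have h2 : ∀ ω ∈ univ.filter (fun ω => U ω = a),
      (p ω).toReal * (-Real.log (p.map U (U ω)).toReal / Real.log 2) =
      (p ω).toReal * (-Real.log (p.map U a).toReal / Real.log 2) := by
    intro ω hω
    rw [(mem_filter.1 hω).2]
  rw [sum_congr rfl h2, ← sum_mul, ← ENNReal.toReal_sum (fun ω _ => p.apply_ne_top ω),
    ← map_apply_fintype p U a, Real.negMulLog]
  ring

/-- Entropy is an expectation of -log of the probability of the observed value, so only these
probabilities at support points matter and not the labels. -/
theorem rvEntropy_congr [Finite Ω] (p : PMF Ω) (U : Ω → α) (V : Ω → β)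
    (h : ∀ ω ∈ p.support, p.map U (U ω) = p.map V (V ω)) : rvEntropy p U = rvEntropy p V := by
  have := Fintype.ofFinite Ω
  rw [rvEntropy_eq_sum, rvEntropy_eq_sum]
  refine sum_congr rfl fun ω _ => ?_
  by_cases hω : p ω = 0
  · simp [hω]
  · rw [h ω ((p.mem_support_iff ω).2 hω)]

theorem map_comp_apply_of_injective (p : PMF Ω) (U : Ω → α) (g : α → β)
    (hg : Function.Injective g) (ω : Ω) :
    p.map (fun ω => g (U ω)) (g (U ω)) = p.map U (U ω) := by
  classical
  rw [PMF.map_apply, PMF.map_apply]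
  simp [hg.eq_iff]

theorem rvEntropy_comp_injective [Finite Ω] (p : PMF Ω) (U : Ω → α) (g : α → β)
    (hg : Function.Injective g) : rvEntropy p (fun ω => g (U ω)) = rvEntropy p U :=
  rvEntropy_congr p _ _ fun ω _ => map_comp_apply_of_injective p U g hg ω

theorem rvEntropy_pair_swap [Finite Ω] (p : PMF Ω) (U : Ω → α) (V : Ω → β) :
    rvEntropy p (fun ω => (U ω, V ω)) = rvEntropy p (fun ω => (V ω, U ω)) :=
  rvEntropy_comp_injective p (fun ω => (V ω, U ω)) Prod.swap Prod.swap_injective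

theorem mutualInfo_comm [Finite Ω] (p : PMF Ω) (U : Ω → α) (V : Ω → β) :
    mutualInfo p U V = mutualInfo p V U := by
  rw [mutualInfo, mutualInfo, rvEntropy_pair_swap p U V]
  ring

theorem rvEntropy_congr_support [Finite Ω] (p : PMF Ω) (U V : Ω → α)
    (h : ∀ ω ∈ p.support, U ω = V ω) : rvEntropy p U = rvEntropy p V := by
  classical
  refine rvEntropy_congr p U V fun ω hω => ?_
  rw [PMF.map_apply, PMF.map_apply]
  refine tsum_congr fun ω' => ?_
  by_cases h0 : p ω' = 0
  · simp [h0]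
  · rw [h ω hω, h ω' ((p.mem_support_iff _).2 h0)]

theorem commonInfo_comm [Finite Ω] (p : PMF Ω) (U : Ω → α) (V : Ω → β) :
    commonInfo p U V = commonInfo p V U := by
  unfold commonInfo
  congr 1
  ext h
  constructor
  · rintro ⟨f, g, hfg, rfl⟩
    exact ⟨g, f, fun ω hω => (hfg ω hω).symm, rvEntropy_congr_support p _ _ hfg⟩
  · rintro ⟨f, g, hfg, rfl⟩
    exact ⟨g, f, fun ω hω => (hfg ω hω).symm, rvEntropy_congr_support p _ _ hfg⟩

theorem residualInfo_comm [Finite Ω] (p : PMF Ω) (U : Ω → α) (V : Ω → β) :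
    residualInfo p U V = residualInfo p V U := by
  rw [residualInfo, residualInfo, mutualInfo_comm, commonInfo_comm]

theorem condEntropy_pair_swap [Finite Ω] (p : PMF Ω) (U : Ω → α) (V : Ω → β) (W : Ω → γ) :
    condEntropy p (fun ω => (U ω, V ω)) W = condEntropy p (fun ω => (V ω, U ω)) W := by
  rw [condEntropy, condEntropy]
  congr 1
  exact rvEntropy_comp_injective p (fun ω => ((V ω, U ω), W ω)) (fun a => (a.1.swap, a.2))
    (by rintro ⟨⟨a, b⟩, c⟩ ⟨⟨a', b'⟩, c'⟩ h; simp_all)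

theorem rvEntropy_le_rvEntropy_id [Finite Ω] (p : PMF Ω) (U : Ω → α) :
    rvEntropy p U ≤ rvEntropy p id := by
  have := Fintype.ofFinite Ω
  rw [rvEntropy_eq_sum, rvEntropy_eq_sum]
  refine sum_le_sum fun ω _ => ?_
  by_cases h0 : p ω = 0
  · simp [h0]
  refine mul_le_mul_of_nonneg_left ?_ ENNReal.toReal_nonneg
  refine div_le_div_of_nonneg_right (neg_le_neg ?_) (Real.log_nonneg (by norm_num))
  rw [PMF.map_id]
  exact Real.log_le_log (ENNReal.toReal_pos h0 (p.apply_ne_top ω))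
    (ENNReal.toReal_mono ((p.map U).apply_ne_top _) (apply_le_map_apply p U ω))

/-- The set in `commonInfo` is bounded above by the entropy of the whole space, so its real supremum
is a genuine one. -/
theorem rvEntropy_le_commonInfo [Finite Ω] (p : PMF Ω) (U : Ω → α) (V : Ω → β) (f : α → ℕ)
    (g : β → ℕ) (h : ∀ ω ∈ p.support, f (U ω) = g (V ω)) :
    rvEntropy p (fun ω => f (U ω)) ≤ commonInfo p U V := by
  refine le_csSup ⟨rvEntropy p id, ?_⟩ ⟨f, g, h, rfl⟩
  rintro _ ⟨f, g, -, rfl⟩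
  exact rvEntropy_le_rvEntropy_id p _

/-- A form of Gibbs' inequality: if `E[ρ(A) ω(S)] ≤ 1`, where `ρ` is the law of `A`, then
`E[log ω(S)] ≤ H(A)`. -/
theorem sum_log_le_entropy [Fintype Ω] (p : PMF Ω) (ρ : PMF α) (j : Ω → α → ℝ≥0∞)
    (hp : ∀ s, ∑' a, j s a = p s) (hρ : ∀ a, ∑ s, j s a = ρ a) (w : Ω → ℝ≥0∞)
    (hw : ∀ s, p s ≠ 0 → w s ≠ 0 ∧ w s ≠ ∞)
    (hle : ∑' a, ∑ s, j s a * ρ a * w s ≤ 1) (hfin : entropy ρ ≠ ∞) :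
    ∑ s, (p s).toReal * (Real.log (w s).toReal / Real.log 2) ≤ (entropy ρ).toReal := by
  have hlog2 : 0 < Real.log 2 := Real.log_pos (by norm_num)
  have hnn : ∀ a, 0 ≤ Real.negMulLog (ρ a).toReal / Real.log 2 := fun a =>
    div_nonneg (Real.negMulLog_nonneg ENNReal.toReal_nonneg
      (ENNReal.toReal_mono ENNReal.one_ne_top (ρ.coe_le_one a))) hlog2.le
  have hent : HasSum (fun a => Real.negMulLog (ρ a).toReal / Real.log 2) (entropy ρ).toReal := by
    have := ENNReal.hasSum_toReal (f := fun a =>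
      ENNReal.ofReal (Real.negMulLog (ρ a).toReal / Real.log 2)) hfin
    rw [← ENNReal.tsum_toReal_eq (fun a => ENNReal.ofReal_ne_top)] at this
    simp only [ENNReal.toReal_ofReal (hnn _)] at this
    exact this
  have hj : ∀ s a, j s a ≠ ∞ := fun s a =>
    ne_top_of_le_ne_top (p.apply_ne_top s) (hp s ▸ ENNReal.le_tsum a)
  have hjp : ∀ s a, j s a ≠ 0 → p s ≠ 0 := fun s a h h0 =>
    h (le_antisymm ((ENNReal.le_tsum a).trans_eq ((hp s).trans h0)) zero_le)
  have hjρ : ∀ s a, j s a ≠ 0 → ρ a ≠ 0 := fun s a h h0 => by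
    have := single_le_sum (f := fun s => j s a) (fun _ _ => zero_le) (mem_univ s)
    rw [hρ a, h0] at this
    exact h (le_antisymm this zero_le)
  have hjs : ∀ s, HasSum (fun a => (j s a).toReal) (p s).toReal := fun s => by
    have := ENNReal.hasSum_toReal (f := fun a => j s a) (by rw [hp]; exact p.apply_ne_top s)
    rwa [← ENNReal.tsum_toReal_eq (hj s), hp] at this
  have hρs : HasSum (fun a => (ρ a).toReal) 1 := by
    have := ENNReal.hasSum_toReal (f := fun a => ρ a) (by rw [ρ.tsum_coe]; simp)
    rwa [← ENNReal.tsum_toReal_eq (fun a => ρ.apply_ne_top a), ρ.tsum_coe, ENNReal.toReal_one]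
      at this
  have htop : ∑' a, ∑ s, j s a * ρ a * w s ≠ ∞ := ne_top_of_le_ne_top ENNReal.one_ne_top hle
  have hes := ENNReal.hasSum_toReal htop
  have hes1 : (∑' a, (∑ s, j s a * ρ a * w s).toReal) ≤ 1 := by
    rw [← ENNReal.tsum_toReal_eq (fun a => ENNReal.ne_top_of_tsum_ne_top htop a)]
    exact ENNReal.toReal_mono ENNReal.one_ne_top hle
  have hleft : HasSum (fun a => ∑ s, (j s a).toReal * Real.log (w s).toReal)
      (∑ s, (p s).toReal * Real.log (w s).toReal) :=
    hasSum_sum fun s _ => (hjs s).mul_right _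
  -- Termwise this is log t ≤ t - 1 at t = ρ(a) w(s), multiplied by j(s,a). The correction terms on
  -- the right sum over a to at most 1 - 1 = 0.
  have hkey : ∀ a, ∑ s, (j s a).toReal * Real.log (w s).toReal ≤
      Real.log 2 * (Real.negMulLog (ρ a).toReal / Real.log 2) +
        ((∑ s, j s a * ρ a * w s).toReal - (ρ a).toReal) := by
    intro a
    have hterm : ∀ s, j s a * ρ a * w s ≠ ∞ := fun s => by
      have := ENNReal.ne_top_of_tsum_ne_top htop a
      exact ne_top_of_le_ne_top this
        (single_le_sum (f := fun s => j s a * ρ a * w s) (fun _ _ => zero_le) (mem_univ s))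
    have hρa : (ρ a).toReal = ∑ s, (j s a).toReal := by
      rw [← hρ a, ENNReal.toReal_sum (fun s _ => hj s a)]
    rw [ENNReal.toReal_sum (fun s _ => hterm s), mul_div_cancel₀ _ hlog2.ne', Real.negMulLog]
    have : -(ρ a).toReal * Real.log (ρ a).toReal + (∑ s, (j s a * ρ a * w s).toReal -
        (ρ a).toReal) = ∑ s, (-(j s a).toReal * Real.log (ρ a).toReal +
          ((j s a * ρ a * w s).toReal - (j s a).toReal)) := by
      rw [sum_add_distrib, sum_sub_distrib, ← sum_mul, sum_neg_distrib, ← hρa]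
    rw [this]
    refine sum_le_sum fun s _ => ?_
    by_cases h0 : j s a = 0
    · simp [h0]
    have hw0 := hw s (hjp s a h0)
    have hwpos := ENNReal.toReal_pos hw0.1 hw0.2
    have hρpos := ENNReal.toReal_pos (hjρ s a h0) (ρ.apply_ne_top a)
    have hl := Real.log_le_sub_one_of_pos (mul_pos hρpos hwpos)
    rw [Real.log_mul hρpos.ne' hwpos.ne'] at hl
    have := mul_le_mul_of_nonneg_left hl (ENNReal.toReal_nonneg (a := j s a))
    rw [ENNReal.toReal_mul, ENNReal.toReal_mul]
    linarith
  have hfinal := hasSum_le hkey hleft ((hent.mul_left (Real.log 2)).add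
    ((ENNReal.summable_toReal htop).hasSum.sub hρs))
  have : ∑ s, (p s).toReal * Real.log (w s).toReal ≤ Real.log 2 * (entropy ρ).toReal := by
    linarith
  rw [← div_le_iff₀' hlog2] at this
  refine le_trans (le_of_eq ?_) this
  rw [sum_div]
  exact sum_congr rfl fun s _ => (mul_div_assoc _ _ _).symm

end Information

/-! ### The lower bound for three abstract discrete variables. -/

section Abstract

variable {Ω υ ξ ζ α β γ : Type*}

/-- The sum over `s` of the terms that occur together with given values of two links. -/
theorem sum_mul_ratio_le [Fintype Ω] (p : PMF Ω) (V : Ω → ξ) (W : Ω → ζ) (k : ξ → ℝ≥0∞)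
    (j : Ω → ℝ≥0∞) (w₀ : ζ) (P : ℝ≥0∞) (hj : ∀ s, j s ≤ k (V s) * p s)
    (hW : ∀ s, j s ≠ 0 → W s = w₀) (hV : ∀ s s', j s ≠ 0 → j s' ≠ 0 → V s = V s' → s = s') :
    ∑ s, j s * (P * p.map (fun s => (V s, W s)) (V s, W s) / (p.map W (W s) * p s)) ≤
      (P / p.map W w₀) * ∑ s, (Set.indicator {s | W s = w₀} (fun s => k (V s) * p s) s) := by
  classical
  -- After `j s` is replaced by its upper bound, the factor `p s` cancels; the probability of the
  -- pair (V, W) is then expanded over all s' with the same pair.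
  have hterm : ∀ s,
      j s * (P * p.map (fun s => (V s, W s)) (V s, W s) / (p.map W (W s) * p s)) ≤
      ∑ s', if j s ≠ 0 ∧ V s' = V s then
        (P / p.map W w₀) * (Set.indicator {s | W s = w₀} (fun s => k (V s) * p s) s') else 0 := by
    intro s
    by_cases h0 : j s = 0
    · simp [h0]
    have hp0 : p s ≠ 0 := fun h => h0 (le_antisymm ((hj s).trans (by simp [h])) zero_le)
    have hws := hW s h0
    have hPW : p.map W w₀ ≠ 0 := fun h =>
      hp0 (le_antisymm ((apply_le_map_apply p W s).trans (by rw [hws, h])) zero_le)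
    calc j s * (P * p.map (fun s => (V s, W s)) (V s, W s) / (p.map W (W s) * p s))
        ≤ k (V s) * p s * (P * p.map (fun s => (V s, W s)) (V s, W s) / (p.map W (W s) * p s)) :=
          mul_le_mul_left (hj s) _
      _ = (P / p.map W w₀) * (k (V s) * p.map (fun s => (V s, W s)) (V s, W s)) *
            (p s * (p s)⁻¹) := by
          rw [hws, div_eq_mul_inv, div_eq_mul_inv, ENNReal.mul_inv (Or.inl hPW)
            (Or.inl ((p.map W).apply_ne_top _))]
          ring
      _ = (P / p.map W w₀) * (k (V s) * p.map (fun s => (V s, W s)) (V s, W s)) := by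
          rw [ENNReal.mul_inv_cancel hp0 (p.apply_ne_top s), mul_one]
      _ ≤ _ := by
          rw [map_apply_fintype p (fun s => (V s, W s)), mul_sum, mul_sum, sum_filter]
          refine sum_le_sum fun s' _ => ?_
          by_cases h : V s' = V s
          · by_cases h' : W s' = w₀
            · simp [h, h', hws, h0]
            · simp [h, h', hws]
          · simp [h]
  refine (sum_le_sum fun s _ => hterm s).trans ?_
  rw [sum_comm, mul_sum]
  refine sum_le_sum fun s' _ => ?_
  -- For given s' at most one s contributes, because V separates the points where `j` does not
  -- vanish.
  rw [← sum_filter, sum_const]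
  refine (nsmul_le_nsmul_left (m := 1) zero_le ?_).trans (one_nsmul _).le
  refine card_le_one.2 fun a ha b hb => ?_
  simp only [mem_filter, mem_univ, true_and] at ha hb
  exact hV a b ha.1 hb.1 (ha.2.symm.trans hb.2)

/-- The basic lower bound.  `J s a b c` is the joint distribution of a finite random variable and
of three discrete ones `A`, `B`, `C` such that `(B, C) - V - S` and `(A, B) - W - S` are Markov
chains, `(A, B)` determines `W` and `(A, C)` determines `U`. -/
theorem residualInfo_add_condEntropy_le_entropy [Finite Ω] (p : PMF Ω) (U : Ω → υ) (V : Ω → ξ)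
    (W : Ω → ζ) (hinj : ∀ s s', U s = U s' → V s = V s' → W s = W s' → s = s') (ρ : PMF α)
    (J : Ω → α → β → γ → ℝ≥0∞) (κ₂ : β → γ → ξ → ℝ≥0∞) (κ₃ : α → β → ζ → ℝ≥0∞)
    (h₂ : ∀ s b c, ∑' a, J s a b c = κ₂ b c (V s) * p s)
    (h₃ : ∀ s a b, ∑' c, J s a b c = κ₃ a b (W s) * p s)
    (hW : ∀ s s' a b c c', J s a b c ≠ 0 → J s' a b c' ≠ 0 → W s = W s')
    (hU : ∀ s s' a b b' c, J s a b c ≠ 0 → J s' a b' c ≠ 0 → U s = U s')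
    (hp : ∀ s, ∑' a, ∑' b, ∑' c, J s a b c = p s)
    (hρ : ∀ a, ∑' s, ∑' b, ∑' c, J s a b c = ρ a) :
    ((residualInfo p V W + condEntropy p (fun s => (U s, W s)) V : ℝ) : EReal) ≤
      ((entropy ρ : ℝ≥0∞) : EReal) := by
  classical
  have := Fintype.ofFinite Ω
  by_cases hfin : entropy ρ = ∞
  · simp [hfin]
  -- The conditional law of the second variable given S, once as a function of W and once as a
  -- function of V; `hBB` says that the two agree on the support.
  let B : ζ → β → ℝ≥0∞ := fun w b => ∑' a, κ₃ a b w
  let B' : ξ → β → ℝ≥0∞ := fun v b => ∑' c, κ₂ b c v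
  have hBB : ∀ s b, B (W s) b * p s = B' (V s) b * p s := by
    intro s b
    simp only [B, B']
    rw [← ENNReal.tsum_mul_right, ← ENNReal.tsum_mul_right]
    simp only [← h₃, ← h₂]
    exact ENNReal.tsum_comm
  -- Only finitely many conditional laws occur, so they can be numbered injectively. The number is
  -- the common variable of V and W.
  obtain ⟨enc, henc⟩ := Set.countable_iff_exists_injOn.1
    (Set.finite_range (fun s => B (W s))).countable
  let f : ζ → ℕ := fun w => enc (B w)
  let g : ξ → ℕ := fun v => enc (B' v)
  have hfg : ∀ s ∈ p.support, g (V s) = f (W s) := by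
    intro s hs
    simp only [f, g]
    congr 1
    funext b
    exact ((ENNReal.mul_left_inj ((p.mem_support_iff s).1 hs) (p.apply_ne_top s)).1
      (hBB s b)).symm
  let w : Ω → ℝ≥0∞ := fun s => p.map (fun s => f (W s)) (f (W s)) *
    p.map (fun s => (V s, W s)) (V s, W s) / (p.map W (W s) * p s)
  have hpos1 : ∀ s, p s ≠ 0 → p.map (fun s => f (W s)) (f (W s)) ≠ 0 := fun s h h' =>
    h (le_antisymm ((apply_le_map_apply p (fun s => f (W s)) s).trans_eq h') zero_le)
  have hpos2 : ∀ s, p s ≠ 0 → p.map (fun s => (V s, W s)) (V s, W s) ≠ 0 := fun s h h' =>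
    h (le_antisymm ((apply_le_map_apply p (fun s => (V s, W s)) s).trans_eq h') zero_le)
  have hpos3 : ∀ s, p s ≠ 0 → p.map W (W s) ≠ 0 := fun s h h' =>
    h (le_antisymm ((apply_le_map_apply p W s).trans_eq h') zero_le)
  have hw : ∀ s, p s ≠ 0 → w s ≠ 0 ∧ w s ≠ ∞ := by
    intro s hs
    refine ⟨ENNReal.div_ne_zero.2 ⟨mul_ne_zero (hpos1 s hs) (hpos2 s hs),
      ENNReal.mul_ne_top (PMF.apply_ne_top _ _) (p.apply_ne_top s)⟩,
      ENNReal.div_ne_top (ENNReal.mul_ne_top (PMF.apply_ne_top _ _) (PMF.apply_ne_top _ _))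
        (mul_ne_zero (hpos3 s hs) hs)⟩
  have hJ₂ : ∀ s a b c, J s a b c ≤ κ₂ b c (V s) * p s := fun s a b c =>
    (ENNReal.le_tsum a).trans_eq (h₂ s b c)
  -- The right side is the probability of b and does not involve a. Summing over b therefore gives
  -- 1, and averaging over ρ keeps it.
  have hfix : ∀ a b, ∑' c, ∑ s, J s a b c * w s ≤ ∑ s, B (W s) b * p s := by
    intro a b
    by_cases hz : ∀ s c, J s a b c = 0
    · simp [hz]
    push Not at hz
    obtain ⟨s₀, c₀, h0⟩ := hz
    have hp0 : p s₀ ≠ 0 := fun h => h0 (le_antisymm ((hJ₂ _ _ _ _).trans (by simp [h])) zero_le)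
    have h1 : ∀ c, ∑ s, J s a b c * w s ≤ (p.map (fun s => f (W s)) (f (W s₀)) /
        p.map W (W s₀)) * ∑ s, (Set.indicator {s | W s = W s₀}
          (fun s => κ₂ b c (V s) * p s) s) := by
      intro c
      refine le_trans (le_of_eq ?_) (sum_mul_ratio_le p V W (κ₂ b c) (fun s => J s a b c) (W s₀)
        (p.map (fun s => f (W s)) (f (W s₀))) (fun s => hJ₂ s a b c)
        (fun s h => hW _ _ _ _ _ _ h h0)
        (fun s s' h h' hv => hinj s s' (hU _ _ _ _ _ _ h h') hv (hW _ _ _ _ _ _ h h')))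
      refine sum_congr rfl fun s _ => ?_
      by_cases h : J s a b c = 0
      · simp [h]
      · simp only [w, hW _ _ _ _ _ _ h h0]
    calc ∑' c, ∑ s, J s a b c * w s
        ≤ ∑' c, (p.map (fun s => f (W s)) (f (W s₀)) / p.map W (W s₀)) *
          ∑ s, (Set.indicator {s | W s = W s₀} (fun s => κ₂ b c (V s) * p s) s) :=
          ENNReal.tsum_le_tsum h1
      _ = (p.map (fun s => f (W s)) (f (W s₀)) / p.map W (W s₀)) *
          (B (W s₀) b * p.map W (W s₀)) := by
          rw [ENNReal.tsum_mul_left]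
          congr 1
          rw [Summable.tsum_finsetSum (fun _ _ => ENNReal.summable), map_apply_fintype, mul_sum,
            sum_filter]
          refine sum_congr rfl fun s _ => ?_
          by_cases h : W s = W s₀
          · simp only [Set.indicator, Set.mem_ofPred_eq, h, if_true]
            rw [ENNReal.tsum_mul_right, ← h]
            exact (hBB s b).symm
          · simp [h]
      _ = p.map (fun s => f (W s)) (f (W s₀)) * B (W s₀) b *
          ((p.map W (W s₀))⁻¹ * p.map W (W s₀)) := by rw [div_eq_mul_inv]; ring
      -- On the event that the common label equals that of `s₀`, the conditional law is constant
      -- since `enc` is injective, so the product of the two probabilities becomes a partial sum of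
      -- the total mass of b.
      _ = ∑ s with f (W s) = f (W s₀), B (W s) b * p s := by
          rw [ENNReal.inv_mul_cancel (hpos3 s₀ hp0) (PMF.apply_ne_top _ _), mul_one,
            map_apply_fintype, sum_mul]
          refine sum_congr rfl fun s hs => ?_
          have := henc ⟨s, rfl⟩ ⟨s₀, rfl⟩ (mem_filter.1 hs).2
          simp only at this
          rw [this, mul_comm]
      _ ≤ ∑ s, B (W s) b * p s := sum_le_sum_of_subset (filter_subset _ _)
  have hBsum : ∑' b, ∑ s, B (W s) b * p s = 1 := by
    rw [Summable.tsum_finsetSum (fun _ _ => ENNReal.summable), ← p.tsum_coe, tsum_fintype]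
    refine sum_congr rfl fun s _ => ?_
    refine Eq.trans ?_ (hp s)
    rw [ENNReal.tsum_comm]
    refine tsum_congr fun b => ?_
    simp only [B]
    rw [← ENNReal.tsum_mul_right]
    exact tsum_congr fun a => (h₃ s a b).symm
  have hle : ∑' a, ∑ s, (∑' b, ∑' c, J s a b c) * ρ a * w s ≤ 1 := by
    calc ∑' a, ∑ s, (∑' b, ∑' c, J s a b c) * ρ a * w s
        = ∑' a, ρ a * ∑' b, ∑' c, ∑ s, J s a b c * w s := by
          refine tsum_congr fun a => ?_
          simp only [Summable.tsum_finsetSum (fun _ _ => ENNReal.summable)]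
          rw [mul_sum]
          refine sum_congr rfl fun s _ => ?_
          simp only [ENNReal.tsum_mul_right]
          ring
      _ ≤ ∑' a, ρ a * ∑' b, ∑ s, B (W s) b * p s :=
          ENNReal.tsum_le_tsum fun a => mul_le_mul_right
            (ENNReal.tsum_le_tsum fun b => hfix a b) _
      _ = 1 := by rw [hBsum]; simp [ρ.tsum_coe]
  have hmain := sum_log_le_entropy p ρ (fun s a => ∑' b, ∑' c, J s a b c) hp
    (fun a => by rw [← hρ a, tsum_fintype]) w hw hle hfin
  have hlog : ∑ s, (p s).toReal * (Real.log (w s).toReal / Real.log 2) =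
      rvEntropy p W + rvEntropy p id - rvEntropy p (fun s => f (W s)) -
        rvEntropy p (fun s => (V s, W s)) := by
    simp only [rvEntropy_eq_sum, ← sum_add_distrib, ← sum_sub_distrib]
    refine sum_congr rfl fun s _ => ?_
    by_cases hs : p s = 0
    · simp [hs]
    have e1 := (ENNReal.toReal_pos (hpos1 s hs) (PMF.apply_ne_top _ _)).ne'
    have e2 := (ENNReal.toReal_pos (hpos2 s hs) (PMF.apply_ne_top _ _)).ne'
    have e3 := (ENNReal.toReal_pos (hpos3 s hs) (PMF.apply_ne_top _ _)).ne'
    have e4 := (ENNReal.toReal_pos hs (PMF.apply_ne_top _ _)).ne'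
    simp only [w, ENNReal.toReal_div, ENNReal.toReal_mul]
    rw [Real.log_div (mul_ne_zero e1 e2) (mul_ne_zero e3 e4), Real.log_mul e1 e2,
      Real.log_mul e3 e4, PMF.map_id]
    simp only [id]
    ring
  have hci : rvEntropy p (fun s => f (W s)) ≤ commonInfo p V W := by
    rw [← rvEntropy_congr_support p _ _ hfg]
    exact rvEntropy_le_commonInfo p V W g f hfg
  have hid : rvEntropy p (fun s => ((U s, W s), V s)) = rvEntropy p id :=
    rvEntropy_comp_injective p id (fun s => ((U s, W s), V s)) fun s s' h => by
      simp only [Prod.mk.injEq] at h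
      exact hinj s s' h.1.1 h.2 h.1.2
  have hreal : residualInfo p V W + condEntropy p (fun s => (U s, W s)) V ≤
      (entropy ρ).toReal := by
    rw [residualInfo, mutualInfo, condEntropy, hid]
    linarith
  rw [← ENNReal.ofReal_toReal hfin, EReal.coe_ennreal_ofReal,
    max_eq_left ENNReal.toReal_nonneg]
  exact EReal.coe_le_coe_iff.2 hreal

end Abstract

end SecureThree

namespace SecureThree

universe u v w

/-! ### Prefix-free codes: transcripts determine link histories. -/

/-- In every round the messages of the link history are codewords of `c` and `c'`. -/
def LinkHistory.Follows (c c' : LinkHistory → Set (List Bool)) (l : LinkHistory) : Prop :=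
  ∀ (l₀ : LinkHistory) (e : List Bool × List Bool) (l₁ : LinkHistory), l = l₀ ++ e :: l₁ →
    e.1 ∈ c l₀ ∧ e.2 ∈ c' l₀

theorem LinkHistory.follows_nil (c c' : LinkHistory → Set (List Bool)) :
    LinkHistory.Follows c c' [] := by
  intro l₀ e l₁ h
  simp at h

theorem LinkHistory.Follows.concat {c c' : LinkHistory → Set (List Bool)} {l : LinkHistory}
    (h : LinkHistory.Follows c c' l) {e : List Bool × List Bool} (h₁ : e.1 ∈ c l)
    (h₂ : e.2 ∈ c' l) : LinkHistory.Follows c c' (l ++ [e]) := by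
  intro l₀ e' l₁ heq
  rcases List.eq_nil_or_concat l₁ with rfl | ⟨l₁', e'', rfl⟩
  · obtain ⟨rfl, h'⟩ := List.append_inj' heq rfl
    simp only [List.cons.injEq, and_true] at h'
    subst h'
    exact ⟨h₁, h₂⟩
  · rw [List.concat_eq_append, ← List.cons_append, ← List.append_assoc] at heq
    exact h _ _ _ (List.append_inj' heq rfl).1

theorem PrefixFree.eq_of_append_eq {C : Set (List Bool)} (hC : PrefixFree C)
    {a b r s : List Bool} (ha : a ∈ C) (hb : b ∈ C) (h : a ++ r = b ++ s) : a = b := by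
  rcases List.prefix_or_prefix_of_prefix (List.prefix_append a r)
    (h ▸ List.prefix_append b s) with h' | h'
  · exact hC a ha b hb h'
  · exact (hC b hb a ha h').symm

/-- Two link histories of the same length that follow the same prefix-free codes and have the
same transcript are equal. -/
theorem LinkHistory.Follows.eq_of_transcript_eq {c c' : LinkHistory → Set (List Bool)}
    (hc : ∀ l, PrefixFree (c l)) (hc' : ∀ l, PrefixFree (c' l)) {l l' : LinkHistory}
    (h : LinkHistory.Follows c c' l) (h' : LinkHistory.Follows c c' l')
    (hlen : l.length = l'.length) (ht : l.transcript = l'.transcript) : l = l' := by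
  -- The codes depend on the past, so the induction from the front carries the common prefix `p` of
  -- both histories.
  suffices H : ∀ (l l' p : LinkHistory), LinkHistory.Follows c c' (p ++ l) →
      LinkHistory.Follows c c' (p ++ l') → l.length = l'.length →
      l.transcript = l'.transcript → l = l' from H l l' [] h h' hlen ht
  intro l
  induction l with
  | nil => intro l' p _ _ hlen _; exact (List.length_eq_zero_iff.1 hlen.symm).symm
  | cons e l ih =>
    intro l' p h h' hlen ht
    cases l' with
    | nil => simp at hlen
    | cons e' l' =>
      simp only [LinkHistory.transcript, List.map_cons, List.flatten_cons, Prod.mk.injEq] at ht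
      have he := h p e l rfl
      have he' := h' p e' l' rfl
      have h1 := (hc p).eq_of_append_eq he.1 he'.1 ht.1
      have h2 := (hc' p).eq_of_append_eq he.2 he'.2 ht.2
      have hee : e = e' := Prod.ext h1 h2
      subst hee
      congr 1
      refine ih l' (p ++ [e]) (by simpa using h) (by simpa using h') (by simpa using hlen) ?_
      simp only [LinkHistory.transcript, Prod.mk.injEq]
      exact ⟨List.append_cancel_left ht.1, List.append_cancel_left ht.2⟩

/-! ### The law of the history factorizes over the parties. -/

namespace Protocol

variable {X : Type u} {Y : Type v} {Z : Type w}

theorem step_apply (P : Protocol X Y Z) (x : X) (y : Y) (h h' : History) :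
    P.step x y h h' = ∑' a, P.next1 x h.l12 h.l31 a * ∑' b, P.next2 y h.l12 h.l23 b *
      ∑' c, P.next3 h.l23 h.l31 c *
        (PMF.pure (⟨h.l12 ++ [(a.1, b.1)], h.l23 ++ [(b.2, c.2)], h.l31 ++ [(c.1, a.2)]⟩ :
          History)) h' := by
  simp only [step, PMF.bind_apply]

theorem step_apply_concat (P : Protocol X Y Z) (x : X) (y : Y) (l12 l23 l31 : LinkHistory)
    (e12 e23 e31 : List Bool × List Bool) :
    P.step x y ⟨l12, l23, l31⟩ ⟨l12 ++ [e12], l23 ++ [e23], l31 ++ [e31]⟩ =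
      P.next1 x l12 l31 (e12.1, e31.2) * (P.next2 y l12 l23 (e12.2, e23.1) *
        P.next3 l23 l31 (e31.1, e23.2)) := by
  rw [step_apply, tsum_eq_single (e12.1, e31.2), tsum_eq_single (e12.2, e23.1),
    tsum_eq_single (e31.1, e23.2)]
  · simp
  · rintro ⟨c1, c2⟩ hc
    rw [PMF.pure_apply_of_ne, mul_zero]
    rintro heq
    apply hc
    simp only [History.mk.injEq, List.append_cancel_left_eq, List.cons.injEq, and_true] at heq
    exact Prod.ext (congrArg Prod.fst heq.2.2).symm (congrArg Prod.snd heq.2.1).symm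
  · rintro ⟨b1, b2⟩ hb
    rw [ENNReal.tsum_eq_zero.2, mul_zero]
    rintro ⟨c1, c2⟩
    rw [PMF.pure_apply_of_ne, mul_zero]
    rintro heq
    apply hb
    simp only [History.mk.injEq, List.append_cancel_left_eq, List.cons.injEq, and_true] at heq
    exact Prod.ext (congrArg Prod.snd heq.1).symm (congrArg Prod.fst heq.2.1).symm
  · rintro ⟨a1, a2⟩ ha
    rw [ENNReal.tsum_eq_zero.2, mul_zero]
    rintro ⟨b1, b2⟩
    rw [ENNReal.tsum_eq_zero.2, mul_zero]
    rintro ⟨c1, c2⟩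
    rw [PMF.pure_apply_of_ne, mul_zero]
    rintro heq
    apply ha
    simp only [History.mk.injEq, List.append_cancel_left_eq, List.cons.injEq, and_true] at heq
    exact Prod.ext (congrArg Prod.fst heq.1).symm (congrArg Prod.snd heq.2.2).symm

theorem mem_support_step {P : Protocol X Y Z} {x : X} {y : Y} {h h' : History}
    (hh : h' ∈ (P.step x y h).support) :
    ∃ a ∈ (P.next1 x h.l12 h.l31).support, ∃ b ∈ (P.next2 y h.l12 h.l23).support,
      ∃ c ∈ (P.next3 h.l23 h.l31).support,
      h' = ⟨h.l12 ++ [(a.1, b.1)], h.l23 ++ [(b.2, c.2)], h.l31 ++ [(c.1, a.2)]⟩ := by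
  simp only [step, PMF.mem_support_bind_iff, PMF.mem_support_pure_iff] at hh
  obtain ⟨a, ha, b, hb, c, hc, h⟩ := hh
  exact ⟨a, ha, b, hb, c, hc, h⟩

theorem run_succ_apply_concat (P : Protocol X Y Z) (x : X) (y : Y) (t : ℕ)
    (l12 l23 l31 : LinkHistory) (e12 e23 e31 : List Bool × List Bool) :
    P.run x y (t + 1) ⟨l12 ++ [e12], l23 ++ [e23], l31 ++ [e31]⟩ =
      P.run x y t ⟨l12, l23, l31⟩ * (P.next1 x l12 l31 (e12.1, e31.2) *
        (P.next2 y l12 l23 (e12.2, e23.1) * P.next3 l23 l31 (e31.1, e23.2))) := by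
  rw [run, PMF.bind_apply, tsum_eq_single ⟨l12, l23, l31⟩, step_apply_concat]
  intro h hne
  by_contra hcon
  obtain ⟨a, -, b, -, c, -, heq⟩ := mem_support_step
    ((PMF.mem_support_iff _ _).2 (right_ne_zero_of_mul hcon))
  apply hne
  simp only [History.mk.injEq] at heq
  obtain ⟨l12', l23', l31'⟩ := h
  rw [(List.append_inj' heq.1 rfl).1, (List.append_inj' heq.2.1 rfl).1,
    (List.append_inj' heq.2.2 rfl).1]

theorem run_succ_ne_zero {P : Protocol X Y Z} {x : X} {y : Y} {t : ℕ} {h : History}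
    (hh : P.run x y (t + 1) h ≠ 0) : ∃ l12 l23 l31 e12 e23 e31,
      h = ⟨l12 ++ [e12], l23 ++ [e23], l31 ++ [e31]⟩ := by
  rw [← PMF.mem_support_iff, run, PMF.mem_support_bind_iff] at hh
  obtain ⟨h₀, -, hh⟩ := hh
  obtain ⟨a, -, b, -, c, -, rfl⟩ := mem_support_step hh
  exact ⟨_, _, _, _, _, _, rfl⟩

/-- The probability of a history is a product of one factor for each party, which depends only
on that party's view. -/
theorem exists_run_eq_mul (P : Protocol X Y Z) (t : ℕ) :
    ∃ (A : X → LinkHistory → LinkHistory → ℝ≥0∞) (B : Y → LinkHistory → LinkHistory → ℝ≥0∞)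
      (C : LinkHistory → LinkHistory → ℝ≥0∞), ∀ x y h,
      P.run x y t h = A x h.l12 h.l31 * B y h.l12 h.l23 * C h.l23 h.l31 := by
  classical
  induction t with
  | zero =>
    -- Alice's and Bob's factors together cover all three links, so Charlie's can be 1.
    refine ⟨fun _ l l' => if l = [] ∧ l' = [] then 1 else 0,
      fun _ l l' => if l = [] ∧ l' = [] then 1 else 0, fun _ _ => 1, ?_⟩
    rintro x y ⟨l12, l23, l31⟩
    rw [run, PMF.pure_apply]
    by_cases h1 : l12 = [] <;> by_cases h2 : l23 = [] <;> by_cases h3 : l31 = [] <;>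
      simp [h1, h2, h3]
  | succ t ih =>
    obtain ⟨A, B, C, hABC⟩ := ih
    -- Each factor is multiplied by the probability of that party's last messages. An empty link
    -- makes Alice's or Bob's factor vanish, so the default of `getLastD` and `dropLast` on the
    -- empty list never affect the product.
    refine ⟨fun x l l' => if l = [] ∨ l' = [] then 0 else A x l.dropLast l'.dropLast *
        P.next1 x l.dropLast l'.dropLast ((l.getLastD ([], [])).1, (l'.getLastD ([], [])).2),
      fun y l l' => if l = [] ∨ l' = [] then 0 else B y l.dropLast l'.dropLast *
        P.next2 y l.dropLast l'.dropLast ((l.getLastD ([], [])).2, (l'.getLastD ([], [])).1),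
      fun l l' => C l.dropLast l'.dropLast *
        P.next3 l.dropLast l'.dropLast ((l'.getLastD ([], [])).1, (l.getLastD ([], [])).2), ?_⟩
    rintro x y ⟨l12, l23, l31⟩
    by_cases hnil : l12 = [] ∨ l23 = [] ∨ l31 = []
    · have h0 : P.run x y (t + 1) ⟨l12, l23, l31⟩ = 0 := by
        by_contra hcon
        obtain ⟨_, _, _, _, _, _, heq⟩ := run_succ_ne_zero hcon
        simp only [History.mk.injEq] at heq
        rcases hnil with h | h | h <;> simp [h] at heq
      rw [h0]
      rcases hnil with h | h | h <;> simp [h]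
    · push Not at hnil
      obtain ⟨h1, h2, h3⟩ := hnil
      obtain ⟨l12, e12, rfl⟩ := (List.eq_nil_or_concat l12).resolve_left h1
      obtain ⟨l23, e23, rfl⟩ := (List.eq_nil_or_concat l23).resolve_left h2
      obtain ⟨l31, e31, rfl⟩ := (List.eq_nil_or_concat l31).resolve_left h3
      simp only [List.concat_eq_append]
      rw [run_succ_apply_concat, hABC]
      simp
      ring

/-- Both histories share links 12 and 31, so Alice's factors are `A x l12 l31` and `A x' l12 l31`;
exchanging x and x' only permutes the factors of the product. -/
theorem run_mul_run_swap_left (P : Protocol X Y Z) (t : ℕ) (x x' : X) (y y' : Y)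
    (l12 l23 l23' l31 : LinkHistory) :
    P.run x y t ⟨l12, l23, l31⟩ * P.run x' y' t ⟨l12, l23', l31⟩ =
      P.run x' y t ⟨l12, l23, l31⟩ * P.run x y' t ⟨l12, l23', l31⟩ := by
  obtain ⟨A, B, C, h⟩ := P.exists_run_eq_mul t
  simp only [h]
  ring

theorem run_mul_run_swap_right (P : Protocol X Y Z) (t : ℕ) (x x' : X) (y y' : Y)
    (l12 l23 l31 l31' : LinkHistory) :
    P.run x y t ⟨l12, l23, l31⟩ * P.run x' y' t ⟨l12, l23, l31'⟩ =
      P.run x y' t ⟨l12, l23, l31⟩ * P.run x' y t ⟨l12, l23, l31'⟩ := by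
  obtain ⟨A, B, C, h⟩ := P.exists_run_eq_mul t
  simp only [h]
  ring

theorem run_length {P : Protocol X Y Z} {x : X} {y : Y} {t : ℕ} {h : History}
    (hh : P.run x y t h ≠ 0) :
    h.l12.length = t ∧ h.l23.length = t ∧ h.l31.length = t := by
  induction t generalizing h with
  | zero =>
    have : h = ⟨[], [], []⟩ := by
      by_contra hne
      exact hh (PMF.pure_apply_of_ne _ _ hne)
    simp [this]
  | succ t ih =>
    obtain ⟨l12, l23, l31, e12, e23, e31, rfl⟩ := run_succ_ne_zero hh
    rw [run_succ_apply_concat] at hh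
    simpa using ih (left_ne_zero_of_mul hh)

/-- Histories of the same length that occur are determined, link by link, by their
transcripts. -/
theorem link_eq_of_transcript_eq {P : Protocol X Y Z} {pXY : PMF (X × Y)}
    (hfull : FullSupport pXY) (hP : P.UsesPrefixFreeCodes pXY) {x x' : X} {y y' : Y} {t : ℕ}
    {h h' : History} (hh : P.run x y t h ≠ 0) (hh' : P.run x' y' t h' ≠ 0) :
    (h.l12.transcript = h'.l12.transcript → h.l12 = h'.l12) ∧
    (h.l23.transcript = h'.l23.transcript → h.l23 = h'.l23) ∧
    (h.l31.transcript = h'.l31.transcript → h.l31 = h'.l31) := by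
  obtain ⟨c12, c21, c23, c32, c31, c13, hfree, hcode⟩ := hP
  have hfol : ∀ (x : X) (y : Y) (t : ℕ) (h : History), P.run x y t h ≠ 0 →
      h.l12.Follows c12 c21 ∧ h.l23.Follows c23 c32 ∧ h.l31.Follows c31 c13 := by
    intro x y t
    induction t with
    | zero =>
      intro h hh
      have : h = ⟨[], [], []⟩ := by
        by_contra hne
        exact hh (PMF.pure_apply_of_ne _ _ hne)
      subst this
      exact ⟨LinkHistory.follows_nil _ _, LinkHistory.follows_nil _ _,
        LinkHistory.follows_nil _ _⟩
    | succ t ih =>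
      intro h hh
      obtain ⟨l12, l23, l31, e12, e23, e31, rfl⟩ := run_succ_ne_zero hh
      rw [run_succ_apply_concat] at hh
      have h0 := left_ne_zero_of_mul hh
      have h123 := right_ne_zero_of_mul hh
      have h23 := right_ne_zero_of_mul h123
      obtain ⟨f12, f23, f31⟩ := ih _ h0
      obtain ⟨k1, k2, k3⟩ := hcode (x, y) ((PMF.mem_support_iff _ _).2 (hfull x y)) t
        ⟨l12, l23, l31⟩ ((PMF.mem_support_iff _ _).2 h0)
      have k1 := k1 _ ((PMF.mem_support_iff _ _).2 (left_ne_zero_of_mul h123))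
      have k2 := k2 _ ((PMF.mem_support_iff _ _).2 (left_ne_zero_of_mul h23))
      have k3 := k3 _ ((PMF.mem_support_iff _ _).2 (right_ne_zero_of_mul h23))
      exact ⟨f12.concat k1.1 k2.1, f23.concat k2.2 k3.2, f31.concat k3.1 k1.2⟩
  obtain ⟨f12, f23, f31⟩ := hfol _ _ _ _ hh
  obtain ⟨f12', f23', f31'⟩ := hfol _ _ _ _ hh'
  obtain ⟨n12, n23, n31⟩ := run_length hh
  obtain ⟨n12', n23', n31'⟩ := run_length hh'
  exact ⟨f12.eq_of_transcript_eq (fun l => (hfree l).1) (fun l => (hfree l).2.1) f12'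
      (n12.trans n12'.symm),
    f23.eq_of_transcript_eq (fun l => (hfree l).2.2.1) (fun l => (hfree l).2.2.2.1) f23'
      (n23.trans n23'.symm),
    f31.eq_of_transcript_eq (fun l => (hfree l).2.2.2.2.1) (fun l => (hfree l).2.2.2.2.2) f31'
      (n31.trans n31'.symm)⟩

/-! ### Termination, final transcripts and the exchange property. -/

/-- The probability that after `t` rounds the protocol has terminated with transcripts `m`. -/
noncomputable def terminatedMass (P : Protocol X Y Z) (x : X) (y : Y) (m : Transcripts)
    (t : ℕ) : ℝ≥0∞ :=
  (P.run x y t).toOuterMeasure {h | P.Terminated x y h ∧ h.transcripts = m}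

theorem finalMass_eq_iSup (P : Protocol X Y Z) (x : X) (y : Y) (m : Transcripts) :
    P.finalMass x y m = ⨆ t, P.terminatedMass x y m t := rfl

theorem Terminated.silence_one {P : Protocol X Y Z} {x : X} {y : Y} {h : History}
    (hh : P.Terminated x y h) : P.Terminated x y (h.silence 1) := by
  intro k
  have : (h.silence 1).silence k = h.silence (k + 1) := by
    simp [History.silence, List.replicate_succ]
  rw [this]
  exact hh (k + 1)

theorem Terminated.step_eq {P : Protocol X Y Z} {x : X} {y : Y} {h : History}
    (hh : P.Terminated x y h) : P.step x y h = PMF.pure (h.silence 1) := by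
  have h0 : h.silence 0 = h := by simp [History.silence]
  obtain ⟨h1, h2, h3⟩ := hh 0
  rw [h0] at h1 h2 h3
  simp [step, h1, h2, h3, History.silence]

theorem transcripts_silence_one (h : History) : (h.silence 1).transcripts = h.transcripts := by
  simp [History.silence, History.transcripts, LinkHistory.transcript]

/-- A terminated history continues almost surely with a silent round, which preserves both
termination and the transcripts. -/
theorem monotone_terminatedMass (P : Protocol X Y Z) (x : X) (y : Y) (m : Transcripts) :
    Monotone (P.terminatedMass x y m) := by
  classical
  refine monotone_nat_of_le_succ fun t => ?_
  rw [terminatedMass, terminatedMass, run, PMF.toOuterMeasure_bind_apply,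
    PMF.toOuterMeasure_apply]
  refine ENNReal.tsum_le_tsum fun h => ?_
  by_cases hh : P.Terminated x y h ∧ h.transcripts = m
  · rw [Set.indicator_of_mem (by exact hh), hh.1.step_eq, PMF.toOuterMeasure_pure_apply,
      if_pos ⟨hh.1.silence_one, (transcripts_silence_one h).trans hh.2⟩, mul_one]
  · rw [Set.indicator_of_notMem (by exact hh)]
    exact zero_le

/-- At a fixed round, prefix-freeness leaves only one possible history with given transcripts, so
the mass is a single run probability, to which the factorization applies. -/
theorem terminatedMass_ne_zero {P : Protocol X Y Z} {pXY : PMF (X × Y)}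
    (hfull : FullSupport pXY) (hP : P.UsesPrefixFreeCodes pXY) {x : X} {y : Y} {t : ℕ}
    {m : Transcripts} (hm : P.terminatedMass x y m t ≠ 0) :
    ∃ h, P.run x y t h ≠ 0 ∧ P.Terminated x y h ∧ h.transcripts = m ∧
      P.terminatedMass x y m t = P.run x y t h := by
  rw [terminatedMass, Ne, PMF.toOuterMeasure_apply_eq_zero_iff, Set.not_disjoint_iff] at hm
  obtain ⟨h, hs, hh⟩ := hm
  refine ⟨h, (PMF.mem_support_iff _ _).1 hs, hh.1, hh.2, ?_⟩
  rw [terminatedMass, ← PMF.toOuterMeasure_apply_singleton]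
  refine PMF.toOuterMeasure_apply_eq_of_inter_support_eq _ (Set.ext fun h' => ⟨?_, ?_⟩)
  · rintro ⟨hh', hs'⟩
    refine ⟨?_, hs'⟩
    have ht : h'.transcripts = h.transcripts := hh'.2.trans hh.2.symm
    simp only [History.transcripts, Transcripts.mk.injEq] at ht
    have key := link_eq_of_transcript_eq hfull hP ((PMF.mem_support_iff _ _).1 hs')
      ((PMF.mem_support_iff _ _).1 hs)
    obtain ⟨_, _, _⟩ := h
    obtain ⟨_, _, _⟩ := h'
    simp only [Set.mem_singleton_iff, History.mk.injEq]
    exact ⟨key.1 ht.1, key.2.1 ht.2.1, key.2.2 ht.2.2⟩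
  · rintro ⟨rfl, hs'⟩
    exact ⟨hh, hs'⟩

theorem run_le_terminatedMass {P : Protocol X Y Z} {x : X} {y : Y} {t : ℕ} {h : History}
    (hh : P.Terminated x y h) : P.run x y t h ≤ P.terminatedMass x y h.transcripts t := by
  rw [terminatedMass, ← PMF.toOuterMeasure_apply_singleton]
  refine PMF.toOuterMeasure_mono _ ?_
  rintro _ ⟨rfl, -⟩
  exact ⟨hh, rfl⟩

/-- Monotonicity moves both suprema to a common round, so it is enough to compare histories of equal
length. -/
theorem finalMass_mul_finalMass_le {P : Protocol X Y Z} {x x' u u' : X} {y y' v v' : Y}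
    {m m' : Transcripts} (H : ∀ t, P.terminatedMass x y m t * P.terminatedMass x' y' m' t ≤
      P.terminatedMass u v m t * P.terminatedMass u' v' m' t) :
    P.finalMass x y m * P.finalMass x' y' m' ≤ P.finalMass u v m * P.finalMass u' v' m' := by
  rw [finalMass_eq_iSup P x y, finalMass_eq_iSup P x' y', ENNReal.iSup_mul]
  refine iSup_le fun s => ?_
  rw [ENNReal.mul_iSup]
  refine iSup_le fun t => ?_
  refine le_trans (mul_le_mul' (P.monotone_terminatedMass x y m (le_max_left s t))
    (P.monotone_terminatedMass x' y' m' (le_max_right s t))) ((H _).trans ?_)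
  exact mul_le_mul' (le_iSup (P.terminatedMass u v m) _) (le_iSup (P.terminatedMass u' v' m') _)

theorem finalMass_mul_finalMass_swap_left {P : Protocol X Y Z} {pXY : PMF (X × Y)}
    (hfull : FullSupport pXY) (hP : P.UsesPrefixFreeCodes pXY) (x x' : X) (y y' : Y)
    (m12 m23 m23' m31 : LinkTranscript) :
    P.finalMass x y ⟨m12, m23, m31⟩ * P.finalMass x' y' ⟨m12, m23', m31⟩ =
      P.finalMass x' y ⟨m12, m23, m31⟩ * P.finalMass x y' ⟨m12, m23', m31⟩ := by
  have key : ∀ x x' y y', P.finalMass x y ⟨m12, m23, m31⟩ * P.finalMass x' y' ⟨m12, m23', m31⟩ ≤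
      P.finalMass x' y ⟨m12, m23, m31⟩ * P.finalMass x y' ⟨m12, m23', m31⟩ := by
    intro x x' y y'
    refine finalMass_mul_finalMass_le fun t => ?_
    by_cases h0 : P.terminatedMass x y ⟨m12, m23, m31⟩ t = 0
    · simp [h0]
    by_cases h0' : P.terminatedMass x' y' ⟨m12, m23', m31⟩ t = 0
    · simp [h0']
    obtain ⟨⟨l12, l23, l31⟩, hr, ht, hm, e⟩ := terminatedMass_ne_zero hfull hP h0
    obtain ⟨⟨l12', l23', l31'⟩, hr', ht', hm', e'⟩ := terminatedMass_ne_zero hfull hP h0'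
    have hl := link_eq_of_transcript_eq hfull hP hr hr'
    have h12 : l12 = l12' := hl.1
      ((congrArg Transcripts.m12 hm).trans (congrArg Transcripts.m12 hm').symm)
    have h31 : l31 = l31' := hl.2.2
      ((congrArg Transcripts.m31 hm).trans (congrArg Transcripts.m31 hm').symm)
    subst h12 h31
    rw [e, e', run_mul_run_swap_left, ← hm, ← hm']
    -- Termination also splits by party: Alice's condition involves only her input and the shared
    -- links, so it moves with her input to the other execution.
    exact mul_le_mul'
      (run_le_terminatedMass fun k => ⟨(ht' k).1, (ht k).2.1, (ht k).2.2⟩)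
      (run_le_terminatedMass fun k => ⟨(ht k).1, (ht' k).2.1, (ht' k).2.2⟩)
  exact le_antisymm (key x x' y y') (key x' x y y')

theorem finalMass_mul_finalMass_swap_right {P : Protocol X Y Z} {pXY : PMF (X × Y)}
    (hfull : FullSupport pXY) (hP : P.UsesPrefixFreeCodes pXY) (x x' : X) (y y' : Y)
    (m12 m23 m31 m31' : LinkTranscript) :
    P.finalMass x y ⟨m12, m23, m31⟩ * P.finalMass x' y' ⟨m12, m23, m31'⟩ =
      P.finalMass x y' ⟨m12, m23, m31⟩ * P.finalMass x' y ⟨m12, m23, m31'⟩ := by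
  have key : ∀ x x' y y', P.finalMass x y ⟨m12, m23, m31⟩ * P.finalMass x' y' ⟨m12, m23, m31'⟩ ≤
      P.finalMass x y' ⟨m12, m23, m31⟩ * P.finalMass x' y ⟨m12, m23, m31'⟩ := by
    intro x x' y y'
    refine finalMass_mul_finalMass_le fun t => ?_
    by_cases h0 : P.terminatedMass x y ⟨m12, m23, m31⟩ t = 0
    · simp [h0]
    by_cases h0' : P.terminatedMass x' y' ⟨m12, m23, m31'⟩ t = 0
    · simp [h0']
    obtain ⟨⟨l12, l23, l31⟩, hr, ht, hm, e⟩ := terminatedMass_ne_zero hfull hP h0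
    obtain ⟨⟨l12', l23', l31'⟩, hr', ht', hm', e'⟩ := terminatedMass_ne_zero hfull hP h0'
    have hl := link_eq_of_transcript_eq hfull hP hr hr'
    have h12 : l12 = l12' := hl.1
      ((congrArg Transcripts.m12 hm).trans (congrArg Transcripts.m12 hm').symm)
    have h23 : l23 = l23' := hl.2.1
      ((congrArg Transcripts.m23 hm).trans (congrArg Transcripts.m23 hm').symm)
    subst h12 h23
    rw [e, e', run_mul_run_swap_right, ← hm, ← hm']
    exact mul_le_mul'
      (run_le_terminatedMass fun k => ⟨(ht k).1, (ht' k).2.1, (ht k).2.2⟩)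
      (run_le_terminatedMass fun k => ⟨(ht' k).1, (ht k).2.1, (ht' k).2.2⟩)
  exact le_antisymm (key x x' y y') (key x x' y' y)

end Protocol

/-! ### Correctness and privacy as identities for the conditional law. -/

theorem map_apply_of_injective {α β : Type*} (p : PMF α) {g : α → β} (hg : Function.Injective g)
    (a : α) : p.map g (g a) = p a := by
  classical
  rw [PMF.map_apply]
  simp [hg.eq_iff]

theorem jointXYZ_apply {X : Type u} {Y : Type v} {Z : Type w} (pXY : PMF (X × Y))
    (pZ : X → Y → PMF Z) (x : X) (y : Y) (z : Z) :
    jointXYZ pXY pZ (x, y, z) = pXY (x, y) * pZ x y z := by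
  classical
  rw [jointXYZ, PMF.bind_apply, tsum_eq_single (x, y)]
  · rw [map_apply_of_injective (g := fun z => (x, y, z)) _ (fun z z' h => by simpa using h)]
  · rintro ⟨x', y'⟩ hne
    rw [(PMF.apply_eq_zero_iff (PMF.map _ _) _).2, mul_zero]
    rintro h
    obtain ⟨z', -, heq⟩ := (PMF.mem_support_map_iff _ _ _).1 h
    simp only [Prod.mk.injEq] at heq
    exact hne (by simp [heq])

/-- The kernel is P(T = a | U = b); when U = b has probability zero, both sides vanish. -/
theorem IsMarkovChain.exists_kernel {Ω α β γ : Type*} {p : PMF Ω} {T : Ω → α} {U : Ω → β}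
    {V : Ω → γ} (h : IsMarkovChain p T U V) :
    ∃ κ : α → β → ℝ≥0∞, ∀ a b c, p.map (fun ω => (T ω, U ω, V ω)) (a, b, c) =
      κ a b * p.map (fun ω => (U ω, V ω)) (b, c) := by
  refine ⟨fun a b => p.map (fun ω => (T ω, U ω)) (a, b) / p.map U b, fun a b c => ?_⟩
  by_cases h0 : p.map U b = 0
  · have h1 : p.map (fun ω => (T ω, U ω, V ω)) (a, b, c) = 0 :=
      le_antisymm ((map_apply_le_map_comp p (fun ω => (T ω, U ω, V ω)) (fun t => t.2.1)
        (a, b, c)).trans_eq h0) zero_le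
    have h2 : p.map (fun ω => (U ω, V ω)) (b, c) = 0 :=
      le_antisymm ((map_apply_le_map_comp p (fun ω => (U ω, V ω)) Prod.fst
        (b, c)).trans_eq h0) zero_le
    rw [h1, h2, mul_zero]
  · rw [ENNReal.mul_comm_div, ← mul_div_assoc, ← h a b c,
      ENNReal.mul_div_cancel_right h0 (PMF.apply_ne_top _ _)]

namespace Protocol

variable {X : Type u} {Y : Type v} {Z : Type w}

/-- The probability of an output and final transcripts, given the inputs. -/
noncomputable def condMass (P : Protocol X Y Z) (x : X) (y : Y) (z : Z)
    (m12 m23 m31 : LinkTranscript) : ℝ≥0∞ :=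
  P.finalMass x y ⟨m12, m23, m31⟩ * P.out3 m23 m31 z

theorem law_apply (P : Protocol X Y Z) (pXY : PMF (X × Y)) (hP : P.IsWellFormed pXY)
    (x : X) (y : Y) (z : Z) (m12 m23 m31 : LinkTranscript) :
    P.law pXY hP ⟨x, y, z, m12, m23, m31⟩ = pXY (x, y) * P.condMass x y z m12 m23 m31 := by
  classical
  rw [law, PMF.bindOnSupport_apply, tsum_eq_single (x, y)]
  · by_cases h : pXY (x, y) = 0
    · simp [h]
    · rw [dif_neg h, PMF.bind_apply, tsum_eq_single ⟨m12, m23, m31⟩]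
      · rw [map_apply_of_injective (g := fun z => (⟨x, y, z, m12, m23, m31⟩ : Outcome X Y Z)) _
          (fun z z' h => by simpa using h)]
        rfl
      · rintro ⟨n12, n23, n31⟩ hne
        rw [(PMF.apply_eq_zero_iff (PMF.map _ _) _).2, mul_zero]
        rintro h
        obtain ⟨z', -, heq⟩ := (PMF.mem_support_map_iff _ _ _).1 h
        simp only [Outcome.mk.injEq] at heq
        exact hne (by simp [heq])
  · rintro ⟨x', y'⟩ hne
    by_cases h : pXY (x', y') = 0
    · simp [h]
    · rw [dif_neg h, PMF.bind_apply, ENNReal.tsum_eq_zero.2, mul_zero]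
      rintro ⟨n12, n23, n31⟩
      rw [(PMF.apply_eq_zero_iff (PMF.map _ _) _).2, mul_zero]
      rintro h
      obtain ⟨z', -, heq⟩ := (PMF.mem_support_map_iff _ _ _).1 h
      simp only [Outcome.mk.injEq] at heq
      exact hne (by simp [heq])

section Secure

variable {P : Protocol X Y Z} {pXY : PMF (X × Y)} {pZ : X → Y → PMF Z}
  {hP : P.IsWellFormed pXY}

/-- Full support allows cancelling the input probability. What remains, here and in the privacy
kernels below, concerns the conditional law alone and so can be used with any input distribution. -/
theorem IsSecure.tsum_condMass (hsec : P.IsSecure pXY pZ hP) (hfull : FullSupport pXY)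
    (x : X) (y : Y) (z : Z) :
    ∑' m12, ∑' m23, ∑' m31, P.condMass x y z m12 m23 m31 = pZ x y z := by
  have h := congrArg (fun p => p (x, y, z)) hsec.correct
  simp only [jointXYZ_apply] at h
  rw [map_apply_eq_tsum_of_fiber (P.law pXY hP) (fun o => (o.x, o.y, o.z)) (x, y, z)
    (fun m : LinkTranscript × LinkTranscript × LinkTranscript => ⟨x, y, z, m.1, m.2.1, m.2.2⟩)]
    at h
  · simp only [law_apply] at h
    rw [ENNReal.tsum_mul_left, ENNReal.mul_right_inj (hfull x y) (pXY.apply_ne_top _)] at h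
    rw [← h]
    exact ((ENNReal.tsum_prod' (f := fun m : LinkTranscript × LinkTranscript × LinkTranscript =>
      P.condMass x y z m.1 m.2.1 m.2.2)).trans (tsum_congr fun m12 => ENNReal.tsum_prod
      (f := fun m23 m31 => P.condMass x y z m12 m23 m31))).symm
  · rintro ⟨a, b, c⟩ ⟨a', b', c'⟩ h
    simpa using h
  · rintro ⟨x', y', z', a, b, c⟩
    simp only [Prod.mk.injEq, Set.mem_range, Outcome.mk.injEq]
    constructor
    · rintro ⟨rfl, rfl, rfl⟩
      exact ⟨(a, b, c), rfl, rfl, rfl, rfl, rfl, rfl⟩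
    · rintro ⟨_, rfl, rfl, rfl, -, -, -⟩
      exact ⟨rfl, rfl, rfl⟩

/-- Privacy against Alice. -/
theorem IsSecure.exists_kernel1 (hsec : P.IsSecure pXY pZ hP) (hfull : FullSupport pXY) :
    ∃ κ : LinkTranscript → LinkTranscript → X → ℝ≥0∞, ∀ x y z m12 m31,
      ∑' m23, P.condMass x y z m12 m23 m31 = κ m12 m31 x * pZ x y z := by
  obtain ⟨κ, hκ⟩ := hsec.private1.exists_kernel
  refine ⟨fun a b x => κ (a, b) x, fun x y z m12 m31 => ?_⟩
  have h := hκ (m12, m31) x (y, z)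
  rw [hsec.correct, jointXYZ_apply, map_apply_eq_tsum_of_fiber _ _ _
    (fun m23 => ⟨x, y, z, m12, m23, m31⟩)] at h
  · simp only [law_apply] at h
    rw [ENNReal.tsum_mul_left, mul_left_comm,
      ENNReal.mul_right_inj (hfull x y) (pXY.apply_ne_top _)] at h
    exact h
  · intro a b h
    simpa using h
  · rintro ⟨x', y', z', a, b, c⟩
    simp only [Prod.mk.injEq, Set.mem_range, Outcome.mk.injEq]
    constructor
    · rintro ⟨⟨rfl, rfl⟩, rfl, rfl, rfl⟩
      exact ⟨b, rfl, rfl, rfl, rfl, rfl, rfl⟩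
    · rintro ⟨_, rfl, rfl, rfl, rfl, -, rfl⟩
      exact ⟨⟨rfl, rfl⟩, rfl, rfl, rfl⟩

/-- Privacy against Bob. -/
theorem IsSecure.exists_kernel2 (hsec : P.IsSecure pXY pZ hP) (hfull : FullSupport pXY) :
    ∃ κ : LinkTranscript → LinkTranscript → Y → ℝ≥0∞, ∀ x y z m12 m23,
      ∑' m31, P.condMass x y z m12 m23 m31 = κ m12 m23 y * pZ x y z := by
  obtain ⟨κ, hκ⟩ := hsec.private2.exists_kernel
  refine ⟨fun a b y => κ (a, b) y, fun x y z m12 m23 => ?_⟩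
  have h := hκ (m12, m23) y (x, z)
  have hσ : Function.Injective (fun s : X × Y × Z => (s.2.1, (s.1, s.2.2))) := by
    rintro ⟨a, b, c⟩ ⟨a', b', c'⟩ h
    simp_all
  have hc : (P.law pXY hP).map (fun o => (o.y, (o.x, o.z))) (y, (x, z)) =
      pXY (x, y) * pZ x y z := by
    rw [← jointXYZ_apply, ← hsec.correct,
      ← map_apply_of_injective ((P.law pXY hP).map _) hσ (x, y, z), PMF.map_comp]
    rfl
  rw [hc, map_apply_eq_tsum_of_fiber _ _ _ (fun m31 => ⟨x, y, z, m12, m23, m31⟩)] at h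
  · simp only [law_apply] at h
    rw [ENNReal.tsum_mul_left, mul_left_comm,
      ENNReal.mul_right_inj (hfull x y) (pXY.apply_ne_top _)] at h
    exact h
  · intro a b h
    simpa using h
  · rintro ⟨x', y', z', a, b, c⟩
    simp only [Prod.mk.injEq, Set.mem_range, Outcome.mk.injEq]
    constructor
    · rintro ⟨⟨rfl, rfl⟩, rfl, rfl, rfl⟩
      exact ⟨c, rfl, rfl, rfl, rfl, rfl, rfl⟩
    · rintro ⟨_, rfl, rfl, rfl, rfl, rfl, -⟩
      exact ⟨⟨rfl, rfl⟩, rfl, rfl, rfl⟩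

/-- Privacy against Charlie. -/
theorem IsSecure.exists_kernel3 (hsec : P.IsSecure pXY pZ hP) (hfull : FullSupport pXY) :
    ∃ κ : LinkTranscript → LinkTranscript → Z → ℝ≥0∞, ∀ x y z m23 m31,
      ∑' m12, P.condMass x y z m12 m23 m31 = κ m23 m31 z * pZ x y z := by
  obtain ⟨κ, hκ⟩ := hsec.private3.exists_kernel
  refine ⟨fun a b z => κ (a, b) z, fun x y z m23 m31 => ?_⟩
  have h := hκ (m23, m31) z (x, y)
  have hσ : Function.Injective (fun s : X × Y × Z => (s.2.2, (s.1, s.2.1))) := by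
    rintro ⟨a, b, c⟩ ⟨a', b', c'⟩ h
    simp_all
  have hc : (P.law pXY hP).map (fun o => (o.z, (o.x, o.y))) (z, (x, y)) =
      pXY (x, y) * pZ x y z := by
    rw [← jointXYZ_apply, ← hsec.correct,
      ← map_apply_of_injective ((P.law pXY hP).map _) hσ (x, y, z), PMF.map_comp]
    rfl
  rw [hc, map_apply_eq_tsum_of_fiber _ _ _ (fun m12 => ⟨x, y, z, m12, m23, m31⟩)] at h
  · simp only [law_apply] at h
    rw [ENNReal.tsum_mul_left, mul_left_comm,
      ENNReal.mul_right_inj (hfull x y) (pXY.apply_ne_top _)] at h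
    exact h
  · intro a b h
    simpa using h
  · rintro ⟨x', y', z', a, b, c⟩
    simp only [Prod.mk.injEq, Set.mem_range, Outcome.mk.injEq]
    constructor
    · rintro ⟨⟨rfl, rfl⟩, rfl, rfl, rfl⟩
      exact ⟨a, rfl, rfl, rfl, rfl, rfl, rfl⟩
    · rintro ⟨_, rfl, rfl, rfl, -, rfl, rfl⟩
      exact ⟨⟨rfl, rfl⟩, rfl, rfl, rfl⟩

theorem condMass_mul_condMass_swap_left (hfull : FullSupport pXY)
    (hP : P.UsesPrefixFreeCodes pXY) (x x' : X) (y y' : Y) (z z' : Z)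
    (m12 m23 m23' m31 : LinkTranscript) :
    P.condMass x y z m12 m23 m31 * P.condMass x' y' z' m12 m23' m31 =
      P.condMass x' y z m12 m23 m31 * P.condMass x y' z' m12 m23' m31 := by
  simp only [condMass]
  rw [mul_mul_mul_comm, finalMass_mul_finalMass_swap_left hfull hP, mul_mul_mul_comm]

theorem condMass_mul_condMass_swap_right (hfull : FullSupport pXY)
    (hP : P.UsesPrefixFreeCodes pXY) (x x' : X) (y y' : Y) (z z' : Z)
    (m12 m23 m31 m31' : LinkTranscript) :
    P.condMass x y z m12 m23 m31 * P.condMass x' y' z' m12 m23 m31' =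
      P.condMass x y' z m12 m23 m31 * P.condMass x' y z' m12 m23 m31' := by
  simp only [condMass]
  rw [mul_mul_mul_comm, finalMass_mul_finalMass_swap_right hfull hP, mul_mul_mul_comm]

/-! ### Each view determines the party's input or output. -/

/-- If two families of weights are exchangeable, the corresponding distributions agree. -/
theorem pmf_eq_of_mul_eq {k k' : ℝ≥0∞} (hk : k ≠ 0) (hk' : k' ≠ 0) (hkt : k ≠ ∞) (hkt' : k' ≠ ∞)
    {p p' : PMF Z}
    (h : ∀ z z', (k * p z) * (k' * p' z') = (k' * p' z) * (k * p z')) : p = p' := by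
  ext z
  have h' : ∀ z', p z * p' z' = p' z * p z' := by
    intro z'
    have := h z z'
    rw [mul_mul_mul_comm, mul_mul_mul_comm k', mul_comm k' k] at this
    exact (ENNReal.mul_right_inj (mul_ne_zero hk hk') (ENNReal.mul_ne_top hkt hkt')).1 this
  -- Summing over z' removes the second factors, as both distributions have total mass 1.
  have : ∑' z', p z * p' z' = ∑' z', p' z * p z' := tsum_congr h'
  rwa [ENNReal.tsum_mul_left, ENNReal.tsum_mul_left, p.tsum_coe, p'.tsum_coe, mul_one, mul_one]
    at this

/-- Alice's input is determined by the transcripts on her two links. -/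
theorem IsSecure.left_eq (hsec : P.IsSecure pXY pZ hP) (hfull : FullSupport pXY)
    (hnormal : NormalForm pZ) {x x' : X} {y y' : Y} {z z' : Z}
    {m12 m23 m23' m31 : LinkTranscript} (h : P.condMass x y z m12 m23 m31 ≠ 0)
    (h' : P.condMass x' y' z' m12 m23' m31 ≠ 0) : x = x' := by
  obtain ⟨κ, hκ⟩ := hsec.exists_kernel1 hfull
  have hne : ∀ {x y z m23}, P.condMass x y z m12 m23 m31 ≠ 0 →
      κ m12 m31 x ≠ 0 ∧ κ m12 m31 x ≠ ∞ := by
    intro x y z m23 h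
    have h1 : κ m12 m31 x * pZ x y z ≠ 0 := by
      rw [← hκ]
      exact fun h0 => h (ENNReal.tsum_eq_zero.1 h0 m23)
    -- The kernel was only obtained in `ℝ≥0∞`. It is finite because its product with a nonzero
    -- output probability is at most that probability.
    refine ⟨left_ne_zero_of_mul h1, fun htop => ?_⟩
    have h2 : κ m12 m31 x * pZ x y z ≤ pZ x y z := by
      rw [← hκ]
      conv_rhs => rw [← hsec.tsum_condMass hfull]
      refine le_trans ?_ (ENNReal.le_tsum m12)
      exact ENNReal.tsum_le_tsum fun m23 => ENNReal.le_tsum m31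
    rw [htop, ENNReal.top_mul (right_ne_zero_of_mul h1)] at h2
    exact (pZ x y).apply_ne_top z (top_le_iff.1 h2)
  refine hnormal.left x x' fun y z => ?_
  -- The kernel depends on x only, so the exchange can be applied at every y, including those not
  -- occurring in `h` and `h'`.
  have hpm : pZ x y = pZ x' y := by
    refine pmf_eq_of_mul_eq (hne h).1 (hne h').1 (hne h).2 (hne h').2 fun z z' => ?_
    simp only [← hκ, ← ENNReal.tsum_mul_left, ← ENNReal.tsum_mul_right]
    exact tsum_congr fun a => tsum_congr fun b =>
      condMass_mul_condMass_swap_left hfull hP.prefixFree x x' y y z z' m12 b a m31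
  rw [hpm]

/-- Bob's input is determined by the transcripts on his two links. -/
theorem IsSecure.right_eq (hsec : P.IsSecure pXY pZ hP) (hfull : FullSupport pXY)
    (hnormal : NormalForm pZ) {x x' : X} {y y' : Y} {z z' : Z}
    {m12 m23 m31 m31' : LinkTranscript} (h : P.condMass x y z m12 m23 m31 ≠ 0)
    (h' : P.condMass x' y' z' m12 m23 m31' ≠ 0) : y = y' := by
  obtain ⟨κ, hκ⟩ := hsec.exists_kernel2 hfull
  have hne : ∀ {x y z m31}, P.condMass x y z m12 m23 m31 ≠ 0 →
      κ m12 m23 y ≠ 0 ∧ κ m12 m23 y ≠ ∞ := by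
    intro x y z m31 h
    have h1 : κ m12 m23 y * pZ x y z ≠ 0 := by
      rw [← hκ]
      exact fun h0 => h (ENNReal.tsum_eq_zero.1 h0 m31)
    refine ⟨left_ne_zero_of_mul h1, fun htop => ?_⟩
    have h2 : κ m12 m23 y * pZ x y z ≤ pZ x y z := by
      rw [← hκ]
      conv_rhs => rw [← hsec.tsum_condMass hfull]
      refine le_trans ?_ (ENNReal.le_tsum m12)
      exact ENNReal.le_tsum (f := fun m23 => ∑' m31, P.condMass x y z m12 m23 m31) m23
    rw [htop, ENNReal.top_mul (right_ne_zero_of_mul h1)] at h2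
    exact (pZ x y).apply_ne_top z (top_le_iff.1 h2)
  refine hnormal.right y y' fun x z => ?_
  have hpm : pZ x y = pZ x y' := by
    refine pmf_eq_of_mul_eq (hne h).1 (hne h').1 (hne h).2 (hne h').2 fun z z' => ?_
    simp only [← hκ, ← ENNReal.tsum_mul_left, ← ENNReal.tsum_mul_right]
    exact tsum_congr fun a => tsum_congr fun b =>
      condMass_mul_condMass_swap_right hfull hP.prefixFree x x y y' z z' m12 m23 b a
  rw [hpm]

/-- Charlie's output is determined by the transcripts on his two links. -/
theorem IsSecure.output_eq (hsec : P.IsSecure pXY pZ hP) (hfull : FullSupport pXY)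
    (hnormal : NormalForm pZ) {x x' : X} {y y' : Y} {z z' : Z}
    {m12 m12' m23 m31 : LinkTranscript} (h : P.condMass x y z m12 m23 m31 ≠ 0)
    (h' : P.condMass x' y' z' m12' m23 m31 ≠ 0) : z = z' := by
  obtain ⟨κ, hκ⟩ := hsec.exists_kernel3 hfull
  have hne : ∀ {x y z m12}, P.condMass x y z m12 m23 m31 ≠ 0 →
      (κ m23 m31 z ≠ 0 ∧ κ m23 m31 z ≠ ∞) ∧ P.out3 m23 m31 z ≠ 0 := by
    intro x y z m12 h
    have h1 : κ m23 m31 z * pZ x y z ≠ 0 := by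
      rw [← hκ]
      exact fun h0 => h (ENNReal.tsum_eq_zero.1 h0 m12)
    refine ⟨⟨left_ne_zero_of_mul h1, fun htop => ?_⟩, right_ne_zero_of_mul h⟩
    have h2 : κ m23 m31 z * pZ x y z ≤ pZ x y z := by
      rw [← hκ]
      conv_rhs => rw [← hsec.tsum_condMass hfull]
      refine ENNReal.tsum_le_tsum fun m12 => (ENNReal.le_tsum m31).trans ?_
      exact ENNReal.le_tsum (f := fun m23 => ∑' m31, P.condMass x y z m12 m23 m31) m23
    rw [htop, ENNReal.top_mul (right_ne_zero_of_mul h1)] at h2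
    exact (pZ x y).apply_ne_top z (top_le_iff.1 h2)
  obtain ⟨⟨k1, k2⟩, o⟩ := hne h
  obtain ⟨⟨k1', k2'⟩, o'⟩ := hne h'
  -- With F the mass of the view given (x, y), F · out(z) = κ(z) p(z|x,y) for every z. Eliminating F
  -- between z and z' gives this ratio, independent of x and y.
  let c : ℝ≥0∞ := (P.out3 m23 m31 z * κ m23 m31 z') / (κ m23 m31 z * P.out3 m23 m31 z')
  have hc : c ≠ ∞ := ENNReal.div_ne_top (ENNReal.mul_ne_top (PMF.apply_ne_top _ _) k2')
    (mul_ne_zero k1 o')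
  refine hnormal.output z z' ⟨c.toNNReal, fun x y => ?_⟩
  rw [ENNReal.coe_toNNReal hc]
  have e : ∀ z, (∑' m12, P.finalMass x y ⟨m12, m23, m31⟩) * P.out3 m23 m31 z =
      κ m23 m31 z * pZ x y z := fun z => by
    rw [← hκ, ← ENNReal.tsum_mul_right]
    rfl
  have e1 := e z
  have e2 := e z'
  rw [← ENNReal.mul_right_inj (mul_ne_zero k1 o') (ENNReal.mul_ne_top k2 (PMF.apply_ne_top _ _)),
    ← mul_assoc, ENNReal.mul_div_cancel (mul_ne_zero k1 o')
      (ENNReal.mul_ne_top k2 (PMF.apply_ne_top _ _))]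
  calc κ m23 m31 z * P.out3 m23 m31 z' * pZ x y z
      = (κ m23 m31 z * pZ x y z) * P.out3 m23 m31 z' := by ring
    _ = (∑' m12, P.finalMass x y ⟨m12, m23, m31⟩) * P.out3 m23 m31 z' * P.out3 m23 m31 z := by
        rw [← e1]; ring
    _ = P.out3 m23 m31 z * κ m23 m31 z' * pZ x y z' := by rw [e2]; ring

end Secure

end Protocol

/-! ### Transcript laws that do not depend on the input distribution. -/

variable {X : Type u} {Y : Type v} {Z : Type w}

theorem supFullSupport_le {pZ : X → Y → PMF Z} {F : PMF (X × Y × Z) → ℝ} {c : EReal}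
    (h : ∀ q, FullSupport q → ((F (jointXYZ q pZ) : ℝ) : EReal) ≤ c) :
    supFullSupport pZ F ≤ c :=
  iSup_le fun q => h q.1 q.2

theorem tsum_input_mul_eq (q : PMF (X × Y)) {M : X → Y → Z → ℝ≥0∞} {d : ℝ≥0∞}
    (hM : ∀ x y, ∑' z, M x y z = d) :
    ∑' s : X × Y × Z, q (s.1, s.2.1) * M s.1 s.2.1 s.2.2 = d := by
  calc ∑' s : X × Y × Z, q (s.1, s.2.1) * M s.1 s.2.1 s.2.2
      = ∑' (x) (y) (z), q (x, y) * M x y z :=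
        (ENNReal.tsum_prod' (f := fun s : X × Y × Z => q (s.1, s.2.1) * M s.1 s.2.1 s.2.2)).trans
          (tsum_congr fun x => ENNReal.tsum_prod (f := fun y z => q (x, y) * M x y z))
    _ = ∑' (x) (y), q (x, y) * d := by simp only [ENNReal.tsum_mul_left, hM]
    _ = (∑' s, q s) * d := by
        rw [ENNReal.tsum_prod']
        simp only [ENNReal.tsum_mul_right]
    _ = d := by rw [q.tsum_coe, one_mul]

theorem tsum_output_eq {pZ : X → Y → PMF Z} {M : X → Y → Z → ℝ≥0∞} {k : ℝ≥0∞} {x : X} {y : Y}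
    (h : ∀ z, M x y z = k * pZ x y z) : ∑' z, M x y z = k := by
  simp only [h, ENNReal.tsum_mul_left, PMF.tsum_coe, mul_one]

/-- Otherwise a level set of `k` and its complement would form a forbidden partition: an output z
possible from both parts forces the value `k' z` on both. -/
theorem Condition1.eq_of_kernel_eq {pZ : X → Y → PMF Z} (hc : Condition1 pZ) {k : X → ℝ≥0∞}
    {k' : Z → ℝ≥0∞} (h : ∀ x y z, k x * pZ x y z = k' z * pZ x y z) (x x' : X) :
    k x = k x' := by
  by_contra hne
  have hk : ∀ {x y z}, 0 < pZ x y z → k x = k' z := fun {x y z} hp =>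
    (ENNReal.mul_left_inj hp.ne' (PMF.apply_ne_top _ _)).1 (h x y z)
  refine hc ⟨{u | k u = k x}, {u | k u = k x}ᶜ, Set.union_compl_self _, Set.inter_compl_self _,
    ⟨x, rfl⟩, ⟨x', fun h => hne h.symm⟩, Set.eq_empty_iff_forall_notMem.2 ?_⟩
  rintro z ⟨⟨u, hu, y, hp⟩, ⟨u', hu', y', hp'⟩⟩
  exact hu' (((hk hp').trans (hk hp).symm).trans hu)

theorem Condition2.eq_of_kernel_eq {pZ : X → Y → PMF Z} (hc : Condition2 pZ) {k : Y → ℝ≥0∞}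
    {k' : Z → ℝ≥0∞} (h : ∀ x y z, k y * pZ x y z = k' z * pZ x y z) (y y' : Y) :
    k y = k y' := by
  by_contra hne
  have hk : ∀ {x y z}, 0 < pZ x y z → k y = k' z := fun {x y z} hp =>
    (ENNReal.mul_left_inj hp.ne' (PMF.apply_ne_top _ _)).1 (h x y z)
  refine hc ⟨{u | k u = k y}, {u | k u = k y}ᶜ, Set.union_compl_self _, Set.inter_compl_self _,
    ⟨y, rfl⟩, ⟨y', fun h => hne h.symm⟩, Set.eq_empty_iff_forall_notMem.2 ?_⟩
  rintro z ⟨⟨x, u, hu, hp⟩, ⟨x', u', hu', hp'⟩⟩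
  exact hu' (((hk hp').trans (hk hp).symm).trans hu)

namespace Protocol

variable {P : Protocol X Y Z} {pXY : PMF (X × Y)} {pZ : X → Y → PMF Z}
  {hP : P.IsWellFormed pXY}

/-- The law of the transcript on a link, in terms of the conditional probabilities. -/
theorem law_map_apply (f : Outcome X Y Z → LinkTranscript) (a : LinkTranscript)
    (e : LinkTranscript → LinkTranscript → Transcripts)
    (he : ∀ b c b' c', e b c = e b' c' → b = b' ∧ c = c')
    (hf : ∀ o : Outcome X Y Z, f o = a ↔ ∃ b c, e b c = ⟨o.m12, o.m23, o.m31⟩) :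
    (P.law pXY hP).map f a = ∑' s : X × Y × Z, pXY (s.1, s.2.1) *
      ∑' b, ∑' c, P.condMass s.1 s.2.1 s.2.2 (e b c).m12 (e b c).m23 (e b c).m31 := by
  rw [map_apply_eq_tsum_of_fiber (P.law pXY hP) f a
    (fun i : (X × Y × Z) × (LinkTranscript × LinkTranscript) => ⟨i.1.1, i.1.2.1, i.1.2.2,
      (e i.2.1 i.2.2).m12, (e i.2.1 i.2.2).m23, (e i.2.1 i.2.2).m31⟩)]
  · simp only [law_apply]
    refine (ENNReal.tsum_prod (f := fun (s : X × Y × Z) (m : LinkTranscript × LinkTranscript) =>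
      pXY (s.1, s.2.1) * P.condMass s.1 s.2.1 s.2.2 (e m.1 m.2).m12 (e m.1 m.2).m23
        (e m.1 m.2).m31)).trans (tsum_congr fun s => ?_)
    rw [ENNReal.tsum_mul_left]
    congr 1
    exact ENNReal.tsum_prod (f := fun b c => P.condMass s.1 s.2.1 s.2.2 (e b c).m12 (e b c).m23
      (e b c).m31)
  · rintro ⟨⟨x, y, z⟩, b, c⟩ ⟨⟨x', y', z'⟩, b', c'⟩ h
    simp only [Outcome.mk.injEq] at h
    obtain ⟨rfl, rfl, rfl, h1, h2, h3⟩ := h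
    obtain ⟨rfl, rfl⟩ := he b c b' c' (by
      cases h : e b c; cases h' : e b' c'; simp_all)
    rfl
  · rintro ⟨x, y, z, m12, m23, m31⟩
    rw [hf]
    constructor
    · rintro ⟨b, c, h⟩
      exact ⟨((x, y, z), (b, c)), by simp [h]⟩
    · rintro ⟨⟨⟨x', y', z'⟩, b, c⟩, h⟩
      simp only [Outcome.mk.injEq] at h
      refine ⟨b, c, ?_⟩
      cases h' : e b c
      simp_all

/-- The law of the transcript on the link between Alice and Bob does not depend on the input
distribution. -/
theorem IsSecure.tsum_m12 (hsec : P.IsSecure pXY pZ hP) (hfull : FullSupport pXY)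
    (q : PMF (X × Y)) (a : LinkTranscript) :
    ∑' s : X × Y × Z, q (s.1, s.2.1) * ∑' b, ∑' c, P.condMass s.1 s.2.1 s.2.2 a b c =
      (P.law pXY hP).map (fun o => o.m12) a := by
  obtain ⟨κ₁, h₁⟩ := hsec.exists_kernel1 hfull
  obtain ⟨κ₂, h₂⟩ := hsec.exists_kernel2 hfull
  obtain ⟨⟨x₀, y₀⟩, -⟩ := pXY.support_nonempty
  have hM : ∀ x y, ∑' z, ∑' b, ∑' c, P.condMass x y z a b c = ∑' c, κ₁ a c x₀ := by
    intro x y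
    have e1 : ∀ x y, ∑' z, ∑' b, ∑' c, P.condMass x y z a b c = ∑' c, κ₁ a c x := fun x y =>
      tsum_output_eq (M := fun x y z => ∑' b, ∑' c, P.condMass x y z a b c) (pZ := pZ) fun z => by
        rw [ENNReal.tsum_comm, ← ENNReal.tsum_mul_right]
        exact tsum_congr fun c => h₁ x y z a c
    have e2 : ∀ x y, ∑' z, ∑' b, ∑' c, P.condMass x y z a b c = ∑' b, κ₂ a b y := fun x y =>
      tsum_output_eq (M := fun x y z => ∑' b, ∑' c, P.condMass x y z a b c) (pZ := pZ) fun z => by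
        rw [← ENNReal.tsum_mul_right]
        exact tsum_congr fun b => h₂ x y z a b
    -- A function of x alone that is also a function of y alone is constant on the product; the
    -- passage goes through (x₀, y).
    rw [e2 x y, ← e2 x₀ y, e1 x₀ y]
  rw [law_map_apply (fun o => o.m12) a (fun b c => ⟨a, b, c⟩) (by simp)
    (fun o => ⟨fun h => ⟨o.m23, o.m31, by rw [← h]⟩, fun ⟨b, c, h⟩ =>
      (congrArg Transcripts.m12 h).symm⟩)]
  exact (tsum_input_mul_eq q (M := fun x y z => ∑' b, ∑' c, P.condMass x y z a b c) hM).trans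
    (tsum_input_mul_eq pXY (M := fun x y z => ∑' b, ∑' c, P.condMass x y z a b c) hM).symm

/-- Under Condition 1, the law of the transcript on the link between Charlie and Alice does not
depend on the input distribution. -/
theorem IsSecure.tsum_m31 (hsec : P.IsSecure pXY pZ hP) (hfull : FullSupport pXY)
    (hc : Condition1 pZ) (q : PMF (X × Y)) (a : LinkTranscript) :
    ∑' s : X × Y × Z, q (s.1, s.2.1) * ∑' b, ∑' c, P.condMass s.1 s.2.1 s.2.2 b c a =
      (P.law pXY hP).map (fun o => o.m31) a := by
  obtain ⟨κ₁, h₁⟩ := hsec.exists_kernel1 hfull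
  obtain ⟨κ₃, h₃⟩ := hsec.exists_kernel3 hfull
  obtain ⟨⟨x₀, y₀⟩, -⟩ := pXY.support_nonempty
  have e1 : ∀ x y z, ∑' b, ∑' c, P.condMass x y z b c a = (∑' b, κ₁ b a x) * pZ x y z := by
    intro x y z
    rw [← ENNReal.tsum_mul_right]
    exact tsum_congr fun b => h₁ x y z b a
  have e3 : ∀ x y z, ∑' b, ∑' c, P.condMass x y z b c a = (∑' c, κ₃ c a z) * pZ x y z := by
    intro x y z
    rw [ENNReal.tsum_comm, ← ENNReal.tsum_mul_right]
    exact tsum_congr fun c => h₃ x y z c a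
  have hM : ∀ x y, ∑' z, ∑' b, ∑' c, P.condMass x y z b c a = ∑' b, κ₁ b a x₀ := fun x y =>
    (tsum_output_eq (M := fun x y z => ∑' b, ∑' c, P.condMass x y z b c a) (e1 x y)).trans
      (hc.eq_of_kernel_eq (k := fun x => ∑' b, κ₁ b a x) (k' := fun z => ∑' c, κ₃ c a z)
        (fun x y z => (e1 x y z).symm.trans (e3 x y z)) x x₀)
  rw [law_map_apply (fun o => o.m31) a (fun b c => ⟨b, c, a⟩) (by simp)
    (fun o => ⟨fun h => ⟨o.m12, o.m23, by rw [← h]⟩, fun ⟨b, c, h⟩ =>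
      (congrArg Transcripts.m31 h).symm⟩)]
  exact (tsum_input_mul_eq q (M := fun x y z => ∑' b, ∑' c, P.condMass x y z b c a) hM).trans
    (tsum_input_mul_eq pXY (M := fun x y z => ∑' b, ∑' c, P.condMass x y z b c a) hM).symm

/-- Under Condition 2, the law of the transcript on the link between Bob and Charlie does not
depend on the input distribution. -/
theorem IsSecure.tsum_m23 (hsec : P.IsSecure pXY pZ hP) (hfull : FullSupport pXY)
    (hc : Condition2 pZ) (q : PMF (X × Y)) (a : LinkTranscript) :
    ∑' s : X × Y × Z, q (s.1, s.2.1) * ∑' b, ∑' c, P.condMass s.1 s.2.1 s.2.2 b a c =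
      (P.law pXY hP).map (fun o => o.m23) a := by
  obtain ⟨κ₂, h₂⟩ := hsec.exists_kernel2 hfull
  obtain ⟨κ₃, h₃⟩ := hsec.exists_kernel3 hfull
  obtain ⟨⟨x₀, y₀⟩, -⟩ := pXY.support_nonempty
  have e2 : ∀ x y z, ∑' b, ∑' c, P.condMass x y z b a c = (∑' b, κ₂ b a y) * pZ x y z := by
    intro x y z
    rw [← ENNReal.tsum_mul_right]
    exact tsum_congr fun b => h₂ x y z b a
  have e3 : ∀ x y z, ∑' b, ∑' c, P.condMass x y z b a c = (∑' c, κ₃ a c z) * pZ x y z := by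
    intro x y z
    rw [ENNReal.tsum_comm, ← ENNReal.tsum_mul_right]
    exact tsum_congr fun c => h₃ x y z a c
  have hM : ∀ x y, ∑' z, ∑' b, ∑' c, P.condMass x y z b a c = ∑' b, κ₂ b a y₀ := fun x y =>
    (tsum_output_eq (M := fun x y z => ∑' b, ∑' c, P.condMass x y z b a c) (e2 x y)).trans
      (hc.eq_of_kernel_eq (k := fun y => ∑' b, κ₂ b a y) (k' := fun z => ∑' c, κ₃ a c z)
        (fun x y z => (e2 x y z).symm.trans (e3 x y z)) y y₀)
  rw [law_map_apply (fun o => o.m23) a (fun b c => ⟨b, a, c⟩) (by simp)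
    (fun o => ⟨fun h => ⟨o.m12, o.m31, by rw [← h]⟩, fun ⟨b, c, h⟩ =>
      (congrArg Transcripts.m23 h).symm⟩)]
  exact (tsum_input_mul_eq q (M := fun x y z => ∑' b, ∑' c, P.condMass x y z b a c) hM).trans
    (tsum_input_mul_eq pXY (M := fun x y z => ∑' b, ∑' c, P.condMass x y z b a c) hM).symm

/-! ### The bound for one link and the six choices of roles. -/

/-- The lower bound for one link, for the joint distribution of inputs and output that belongs
to the input distribution `q`.  The conditional probability `g` of the three transcripts is
`P.condMass`, up to the order of the transcripts. -/
theorem lower_bound_of_kernels [Finite X] [Finite Y] [Finite Z] {υ ξ ζ : Type*}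
    (q : PMF (X × Y)) (pZ : X → Y → PMF Z) (U : X × Y × Z → υ) (V : X × Y × Z → ξ)
    (W : X × Y × Z → ζ) (hinj : ∀ s s', U s = U s' → V s = V s' → W s = W s' → s = s')
    (ρ : PMF LinkTranscript)
    (g : X × Y × Z → LinkTranscript → LinkTranscript → LinkTranscript → ℝ≥0∞)
    (κ₂ : LinkTranscript → LinkTranscript → ξ → ℝ≥0∞)
    (κ₃ : LinkTranscript → LinkTranscript → ζ → ℝ≥0∞)
    (h₂ : ∀ s b c, ∑' a, g s a b c = κ₂ b c (V s) * pZ s.1 s.2.1 s.2.2)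
    (h₃ : ∀ s a b, ∑' c, g s a b c = κ₃ a b (W s) * pZ s.1 s.2.1 s.2.2)
    (hW : ∀ s s' a b c c', g s a b c ≠ 0 → g s' a b c' ≠ 0 → W s = W s')
    (hU : ∀ s s' a b b' c, g s a b c ≠ 0 → g s' a b' c ≠ 0 → U s = U s')
    (hp : ∀ s, ∑' a, ∑' b, ∑' c, g s a b c = pZ s.1 s.2.1 s.2.2)
    (hρ : ∀ a, ∑' s, q (s.1, s.2.1) * ∑' b, ∑' c, g s a b c = ρ a) :
    ((residualInfo (jointXYZ q pZ) V W +
      condEntropy (jointXYZ q pZ) (fun s => (U s, W s)) V : ℝ) : EReal) ≤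
      ((entropy ρ : ℝ≥0∞) : EReal) := by
  have hj : ∀ s, jointXYZ q pZ s = q (s.1, s.2.1) * pZ s.1 s.2.1 s.2.2 := fun s =>
    jointXYZ_apply q pZ s.1 s.2.1 s.2.2
  refine residualInfo_add_condEntropy_le_entropy (jointXYZ q pZ) U V W hinj ρ
    (fun s a b c => q (s.1, s.2.1) * g s a b c) κ₂ κ₃ ?_ ?_ ?_ ?_ ?_ ?_
  · intro s b c
    rw [ENNReal.tsum_mul_left, h₂, hj]
    ring
  · intro s a b
    rw [ENNReal.tsum_mul_left, h₃, hj]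
    ring
  · exact fun s s' a b c c' h h' =>
      hW s s' a b c c' (right_ne_zero_of_mul h) (right_ne_zero_of_mul h')
  · exact fun s s' a b b' c h h' =>
      hU s s' a b b' c (right_ne_zero_of_mul h) (right_ne_zero_of_mul h')
  · intro s
    simp only [ENNReal.tsum_mul_left]
    rw [hp, hj]
  · intro a
    simp only [ENNReal.tsum_mul_left]
    exact hρ a

end Protocol

end SecureThree

theorem mainTheorem6 {X : Type*} {Y : Type*} {Z : Type*} [Finite X] [Finite Y] [Finite Z]
    (pXY : PMF (X × Y)) (pZ : X → Y → PMF Z)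
    (hfull : SecureThree.FullSupport pXY) (hnormal : SecureThree.NormalForm pZ)
    (P : SecureThree.Protocol X Y Z) (hP : P.IsWellFormed pXY) (hsec : P.IsSecure pXY pZ hP) :
    (max
        (SecureThree.supFullSupport pZ fun p =>
          SecureThree.residualInfo p SecureThree.rvX SecureThree.rvZ +
            SecureThree.condEntropy p (fun s => (SecureThree.rvX s, SecureThree.rvY s))
              SecureThree.rvZ)
        (SecureThree.supFullSupport pZ fun p =>
          SecureThree.residualInfo p SecureThree.rvY SecureThree.rvZ +
            SecureThree.condEntropy p (fun s => (SecureThree.rvX s, SecureThree.rvY s))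
              SecureThree.rvZ)
      ≤ ((SecureThree.entropy ((P.law pXY hP).map fun o => o.m12) : ENNReal) : EReal)) ∧
    (SecureThree.Condition1 pZ →
      max
        (SecureThree.supFullSupport pZ fun p =>
          SecureThree.residualInfo p SecureThree.rvY SecureThree.rvZ +
            SecureThree.condEntropy p (fun s => (SecureThree.rvX s, SecureThree.rvZ s))
              SecureThree.rvY)
        (SecureThree.supFullSupport pZ fun p =>
          SecureThree.residualInfo p SecureThree.rvX SecureThree.rvY +
            SecureThree.condEntropy p (fun s => (SecureThree.rvX s, SecureThree.rvZ s))
              SecureThree.rvY)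
      ≤ ((SecureThree.entropy ((P.law pXY hP).map fun o => o.m31) : ENNReal) : EReal)) ∧
    (SecureThree.Condition2 pZ →
      max
        (SecureThree.supFullSupport pZ fun p =>
          SecureThree.residualInfo p SecureThree.rvX SecureThree.rvZ +
            SecureThree.condEntropy p (fun s => (SecureThree.rvY s, SecureThree.rvZ s))
              SecureThree.rvX)
        (SecureThree.supFullSupport pZ fun p =>
          SecureThree.residualInfo p SecureThree.rvX SecureThree.rvY +
            SecureThree.condEntropy p (fun s => (SecureThree.rvY s, SecureThree.rvZ s))
              SecureThree.rvX)
      ≤ ((SecureThree.entropy ((P.law pXY hP).map fun o => o.m23) : ENNReal) : EReal)) := by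
  obtain ⟨κ₁, h₁⟩ := hsec.exists_kernel1 hfull
  obtain ⟨κ₂, h₂⟩ := hsec.exists_kernel2 hfull
  obtain ⟨κ₃, h₃⟩ := hsec.exists_kernel3 hfull
  have hT := hsec.tsum_condMass hfull
  have hX := @SecureThree.Protocol.IsSecure.left_eq _ _ _ _ _ _ _ hsec hfull hnormal
  have hY := @SecureThree.Protocol.IsSecure.right_eq _ _ _ _ _ _ _ hsec hfull hnormal
  have hZ := @SecureThree.Protocol.IsSecure.output_eq _ _ _ _ _ _ _ hsec hfull hnormal
  refine ⟨max_le ?_ ?_, fun hc => max_le ?_ ?_, fun hc => max_le ?_ ?_⟩ <;>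
    refine SecureThree.supFullSupport_le fun q _ => ?_
  -- Roles: `A` = link 12, V = Z as Charlie is not on it. Here W = X and U = Y, so `B` = link 31 and
  -- `C` = link 23; the next case interchanges Alice and Bob.
  · rw [SecureThree.residualInfo_comm, SecureThree.condEntropy_pair_swap]
    refine SecureThree.Protocol.lower_bound_of_kernels q pZ _ _ _ ?_ _
      (fun s a b c => P.condMass s.1 s.2.1 s.2.2 a c b) (fun b c z => κ₃ c b z) κ₁
      (fun s b c => h₃ _ _ _ _ _) (fun s a b => h₁ _ _ _ _ _)
      (fun s s' a b c c' => hX) (fun s s' a b b' c => hY) (fun s => ?_) (fun a => ?_)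
    · rintro ⟨x, y, z⟩ ⟨x', y', z'⟩ hu hv hw
      exact Prod.ext hw (Prod.ext hu hv)
    · rw [← hT]
      exact tsum_congr fun a => ENNReal.tsum_comm
    · rw [← hsec.tsum_m12 hfull q a]
      exact tsum_congr fun s => congrArg _ ENNReal.tsum_comm
  · rw [SecureThree.residualInfo_comm]
    refine SecureThree.Protocol.lower_bound_of_kernels q pZ _ _ _ ?_ _
      (fun s a b c => P.condMass s.1 s.2.1 s.2.2 a b c) κ₃ κ₂
      (fun s b c => h₃ _ _ _ _ _) (fun s a b => h₂ _ _ _ _ _)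
      (fun s s' a b c c' => hY) (fun s s' a b b' c => hX) (fun s => hT _ _ _)
      (hsec.tsum_m12 hfull q)
    rintro ⟨x, y, z⟩ ⟨x', y', z'⟩ hu hv hw
    exact Prod.ext hu (Prod.ext hw hv)
  -- Roles: `A` = link 31, V = Y. First W = Z with `B` = link 23, then W = X with `B` = link 12.
  · refine SecureThree.Protocol.lower_bound_of_kernels q pZ _ _ _ ?_ _
      (fun s a b c => P.condMass s.1 s.2.1 s.2.2 c b a) (fun b c y => κ₂ c b y)
      (fun a b z => κ₃ b a z)
      (fun s b c => h₂ _ _ _ _ _) (fun s a b => h₃ _ _ _ _ _)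
      (fun s s' a b c c' => hZ) (fun s s' a b b' c => hX) (fun s => ?_) (fun a => ?_)
    · rintro ⟨x, y, z⟩ ⟨x', y', z'⟩ hu hv hw
      exact Prod.ext hu (Prod.ext hv hw)
    · rw [← hT, ENNReal.tsum_comm, ENNReal.tsum_comm (α := SecureThree.LinkTranscript)
        (f := fun m12 m23 => ∑' m31, P.condMass s.1 s.2.1 s.2.2 m12 m23 m31)]
      refine tsum_congr fun m23 => ENNReal.tsum_comm
    · rw [← hsec.tsum_m31 hfull hc q a]
      exact tsum_congr fun s => congrArg _ ENNReal.tsum_comm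
  · rw [SecureThree.residualInfo_comm, SecureThree.condEntropy_pair_swap]
    refine SecureThree.Protocol.lower_bound_of_kernels q pZ _ _ _ ?_ _
      (fun s a b c => P.condMass s.1 s.2.1 s.2.2 b c a) κ₂ (fun a b x => κ₁ b a x)
      (fun s b c => h₂ _ _ _ _ _) (fun s a b => h₁ _ _ _ _ _)
      (fun s s' a b c c' => hX) (fun s s' a b b' c => hZ) (fun s => ?_)
      (hsec.tsum_m31 hfull hc q)
    · rintro ⟨x, y, z⟩ ⟨x', y', z'⟩ hu hv hw
      exact Prod.ext hw (Prod.ext hv hu)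
    · rw [← hT, ENNReal.tsum_comm]
      exact tsum_congr fun m12 => ENNReal.tsum_comm
  -- Roles: `A` = link 23, V = X. First W = Z with `B` = link 31, then W = Y with `B` = link 12.
  · refine SecureThree.Protocol.lower_bound_of_kernels q pZ _ _ _ ?_ _
      (fun s a b c => P.condMass s.1 s.2.1 s.2.2 c a b) (fun b c x => κ₁ c b x) κ₃
      (fun s b c => h₁ _ _ _ _ _) (fun s a b => h₃ _ _ _ _ _)
      (fun s s' a b c c' => hZ) (fun s s' a b b' c => hY) (fun s => ?_) (fun a => ?_)
    · rintro ⟨x, y, z⟩ ⟨x', y', z'⟩ hu hv hw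
      exact Prod.ext hv (Prod.ext hu hw)
    · rw [← hT, ENNReal.tsum_comm (α := SecureThree.LinkTranscript)
        (f := fun m12 m23 => ∑' m31, P.condMass s.1 s.2.1 s.2.2 m12 m23 m31)]
      exact tsum_congr fun m23 => ENNReal.tsum_comm
    · rw [← hsec.tsum_m23 hfull hc q a]
      exact tsum_congr fun s => congrArg _ ENNReal.tsum_comm
  · rw [SecureThree.condEntropy_pair_swap]
    refine SecureThree.Protocol.lower_bound_of_kernels q pZ _ _ _ ?_ _
      (fun s a b c => P.condMass s.1 s.2.1 s.2.2 b a c) κ₁ (fun a b y => κ₂ b a y)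
      (fun s b c => h₁ _ _ _ _ _) (fun s a b => h₂ _ _ _ _ _)
      (fun s s' a b c c' => hY) (fun s s' a b b' c => hZ) (fun s => ?_)
      (hsec.tsum_m23 hfull hc q)
    · rintro ⟨x, y, z⟩ ⟨x', y', z'⟩ hu hv hw
      exact Prod.ext hv (Prod.ext hw hu)
    · rw [← hT, ENNReal.tsum_comm]
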